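/- **Setting.** Let $n\ge 2$ and $D\ge 2n+1$ be integers. Closed $(n-1)$-manifolds $M$ are smoothly embedded in $\mathbb R^D$ so that every connected component lies in a slice $\{k\}\times\mathbb R^{D-1}$, $k\in\mathbb N=\{0,1,2,\dots\}$ ($M=\varnothing$ is allowed). Write $M(k)=M\cap(\{k\}\times\mathbb R^{D-1})$ and $s(M)=\{k : M(k)\neq\varnothing\}$. Disjoint $M,N$ are *well-separated* if $s(M)\cap s(N)=\varnothing$. *Fields.* A smooth map $F:[0,1]\times M\to\mathbb R^2=\mathbb C$ with singular set $S(F)=\{x:\operatorname{rank}D_xF<2\}$ is a *fold map* if $S(F)=S_1(F)=\{x:\operatorname{rank}D_xF=1\}$, the jet $j^1F$ is transverse to the rank-one stratum $S_1$ of $J^1([0,1]\times M,\mathbb R^2)$, and $T_xS(F)+\ker D_xF=T_x([0,1]\times M)$ for all $x\in S(F)$. Let $F(k)=F|_{[0,1]\times M(k)}$, let $\operatorname{GenIm}(F(k))$ be the set of $t\in[0,1]$ such that $\operatorname{Im}F$ is injective on $S(F(k))\cap(\{t\}\times M)$, and let $\pitchfork(F(k))$ be the set of $t$ such that $S(F(k))$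 is transverse to $\{t\}\times M(k)$. $F$ is a *fold field* if for all $k\in s(M)$ one has $0,1\in\pitchfork(F(k))\cap\operatorname{GenIm}(F(k))$ and $\operatorname{GenIm}(F(k))$ is residual in $[0,1]$. The Brauer category $\mathbf{Br}$ has objects $[m]$, $m\in\mathbb N$; a morphism $[m]\to[n]$ is a perfect matching (by arcs) of $m$ incoming and $n$ outgoing points together with a number of closed loops; morphisms are composed by gluing (counting new loops) and tensored by juxtaposition. For a fold field $F$, let $\mathbb S(F(k))$ be the morphism whose incoming (outgoing) points are the points of $S(F(k))$ at time $0$ (at time $1$), ordered by increasing imaginary part of $F$, two of them being joined by an arc iff they lie in the same component of $S(F(k))$, and whose loops are the components of $S(F(k))$ with no points at times $0,1$. Put $\mathbb S(F)=\bigotimes_{k\in\mathbb N}\mathbb S(F(k))$. The set $\mathfrak F(M)$ consists of all fold fields $F$ on $[0,1]\times M$ such that $\mathbb S(F)$ is an identity morphism; $\mathfrak F(\varnothing)$ is a one-element set. *Coefficients.* Let $V$ be a real vector space of finite dimension $\ge2$ with a duality structure $(i,e)$: symmetric linear maps $i:\mathbb R\to V\otimes V$ and $e:V\otimes V\to\mathbb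 R$ with $(e\otimes 1_V)(1_V\otimes i)=1_V$. Let $Y$ be the induced representation of $\mathbf{Br}$, which assigns to $\varphi:[m]\to[n]$ a linear map $V^{\otimes m}\to V^{\otimes n}$ (cups go to $i$, caps to $e$, through-strands to $1_V$, loops to the scalar $e\,i=\dim V$); tensor powers are taken with strictly associative tensor product. Assume that $Y$ is faithful on loops: if $Y(\varphi)=Y(\psi)$, then $\varphi,\psi$ have the same number of loops. Put $H_{m,n}=Y(\operatorname{Hom}([m],[n]))$, $Q(H_{m,n})=\mathrm{FM}(H_{m,n})\otimes_{\mathbb N[\tau]}\mathbb B[[q]]$ and $Q=\prod_{m,n\in\mathbb N}Q(H_{m,n})$; here $\mathrm{FM}$ is the free commutative monoid, $\mathbb B=\{0,1\}$ is the Boolean semiring, and $\tau$ acts on $H_{m,n}$ by multiplication by $\dim V$ and on $\mathbb B[[q]]$ by multiplication by $q$. Every element of $Q(H_{m,n})$ is uniquely $\sum_y y\otimes b_y$ with $y$ in the finite set of those elements of $H_{m,n}$ that are not of the form $(\dim V)^jh$, $j>0$, $h\in H_{m,n}$, and infinite sums in $Q(H_{m,n})$ are formed coefficientwise. Two complete idempotent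 continuous semirings have underlying complete additive monoid $Q$: the composition semiring $Q^c$, with $(f\cdot f')_{m,n}=\sum_{p}f_{m,p}\cdot f'_{p,n}$, where $(y\otimes b)\cdot(y'\otimes b')=(y'\circ y)\otimes bb'$, and the monoidal semiring $Q^m$, with $(f\times f')_{m,n}=\sum_{p+r=m,\,q+s=n}f_{p,q}\times f'_{r,s}$, where $(y\otimes b)\times(y'\otimes b')=(y\otimes y')\otimes bb'$. *State modules.* $Z(M)$ is the set of all functions $\mathfrak F(M)\to Q$, with pointwise operations; it is a complete two-sided semimodule over $S$ for both $S=Q^c$ and $S=Q^m$. *Complete tensor product.* Let $A$ and $B$ be complete idempotent continuous two-sided $S$-semimodules, with natural order $a\le a'\iff a+a'=a'$. Then $A\hat\otimes_S B$ is the set of all *tensors*, i.e. functions $f:A\times B\to\mathbb B$ with $f(0,0)=1$, $f(as,b)=f(a,sb)$, $f(a,b)=1$ whenever $a\le\sum\{a':f(a',b)=1\}$, and $f(a,b)=1$ whenever $b\le\sum\{b':f(a,b')=1\}$. The sum of a family of tensors is the smallest tensor above (with support containing that of) every member; $a\hat\otimes b$ is the smallest tensor with value $1$ at $(a,b)$;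 $rf$ (resp. $fr$) is the smallest tensor with value $1$ at all $(ra,b)$ (resp. $(a,br)$) with $f(a,b)=1$. **Proposition.** Let $M,N\subset\mathbb R^D$ be disjoint, well-separated closed $(n-1)$-manifolds as above. Then restriction of maps is a bijection $$\rho:\mathfrak F(M\sqcup N)\xrightarrow{\ \cong\ }\mathfrak F(M)\times\mathfrak F(N),\qquad f\mapsto(f|_{[0,1]\times M},f|_{[0,1]\times N}),$$ and for $S=Q^c$ as well as for $S=Q^m$ there is an isomorphism of two-sided $S$-semimodules $$Z(M)\,\hat\otimes_S\,Z(N)\ \cong\ Z(M\sqcup N)$$ that preserves infinite sums and sends $z\hat\otimes z'$ to the function $f\mapsto z(f|_{[0,1]\times M})\,z'(f|_{[0,1]\times N})$, where the product is taken in $S$. -/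

import Mathlib

open scoped TensorProduct Polynomial

noncomputable section

namespace FoldTFT

set_option linter.unusedSectionVars false

universe u

/-! ### Complete monoids, semirings and semimodules -/

/-- A complete monoid: a commutative monoid with a summation law assigning a sum to every
family, indexed by an arbitrary set `I`. A partition of `I` is given by a map `π : I → J`. -/
class CompleteMonoid (M : Type u) [AddCommMonoid M] where
  isum : ∀ {I : Type u}, (I → M) → M
  isum_empty : ∀ {I : Type u} [IsEmpty I] (f : I → M), isum f = 0
  isum_unique : ∀ {I : Type u} [Unique I] (f : I → M), isum f = f default
  isum_pair : ∀ f : ULift.{u} Bool → M, isum f = f ⟨true⟩ + f ⟨false⟩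
  isum_partition : ∀ {I J : Type u} (π : I → J) (f : I → M),
    isum (fun j : J => isum (fun i : {i : I // π i = j} => f i)) = isum f

/-- The natural order of an idempotent commutative monoid. -/
def NatLE {M : Type*} [AddCommMonoid M] (a b : M) : Prop := a + b = b

/-- A complete monoid is idempotent and continuous. -/
class IdemContinuous (M : Type u) [AddCommMonoid M] [CompleteMonoid M] : Prop where
  add_self : ∀ a : M, a + a = a
  isum_le_of_finite : ∀ {I : Type u} (f : I → M) (c : M),
    (∀ F : Finset I, NatLE (∑ i ∈ F, f i) c) → NatLE (CompleteMonoid.isum f) c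

/-- Infinite distributivity of a scalar action over the summation law. -/
class CompleteModule (R : Type*) (M : Type u) [Semiring R] [AddCommMonoid M] [Module R M]
    [CompleteMonoid M] : Prop where
  smul_isum : ∀ (r : R) {I : Type u} (f : I → M),
    r • CompleteMonoid.isum f = CompleteMonoid.isum (fun i => r • f i)

/-- A complete semiring: both infinite distributive laws hold. -/
class CompleteSemiring (S : Type u) [Semiring S] [CompleteMonoid S] : Prop where
  mul_isum : ∀ (s : S) {I : Type u} (f : I → S),
    s * CompleteMonoid.isum f = CompleteMonoid.isum (fun i => s * f i)
  isum_mul : ∀ (s : S) {I : Type u} (f : I → S),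
    CompleteMonoid.isum f * s = CompleteMonoid.isum (fun i => f i * s)

open CompleteMonoid MulOpposite

section order

variable {M : Type u} [AddCommMonoid M]

theorem NatLE.trans {a b c : M} (h₁ : NatLE a b) (h₂ : NatLE b c) : NatLE a c := by
  unfold NatLE at *; rw [← h₂, ← add_assoc, h₁]

theorem NatLE.antisymm {a b : M} (h₁ : NatLE a b) (h₂ : NatLE b a) : a = b := by
  unfold NatLE at *; rw [← h₂, add_comm, h₁]

theorem natLE_zero (a : M) : NatLE 0 a := zero_add a

theorem NatLE.add_le {a b c : M} (h₁ : NatLE a c) (h₂ : NatLE b c) : NatLE (a + b) c := by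
  unfold NatLE at *; rw [add_assoc, h₂, h₁]

variable [CompleteMonoid M] [IdemContinuous M]

theorem NatLE.refl (a : M) : NatLE a a := IdemContinuous.add_self a

theorem natLE_add_left (a b : M) : NatLE a (a + b) := by
  unfold NatLE; rw [← add_assoc, IdemContinuous.add_self]

theorem natLE_add_right (a b : M) : NatLE b (a + b) := by
  rw [add_comm]; exact natLE_add_left b a

theorem isum_le {I : Type u} {f : I → M} {c : M} (h : ∀ i, NatLE (f i) c) :
    NatLE (isum f) c := by
  classical
  refine IdemContinuous.isum_le_of_finite f c fun F => ?_
  induction F using Finset.induction_on with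
  | empty => simpa using natLE_zero c
  | insert a s ha ih => rw [Finset.sum_insert ha]; exact (h a).add_le ih

theorem le_isum {I : Type u} (f : I → M) (i : I) : NatLE (f i) (isum f) := by
  classical
  rw [← isum_partition (fun j : I => (ULift.up (decide (j = i)) : ULift.{u} Bool)) f, isum_pair]
  have : isum (fun j : {j : I // (ULift.up (decide (j = i)) : ULift.{u} Bool) = ⟨true⟩} => f j)
      = f i := by
    let _ : Unique {j : I // (ULift.up (decide (j = i)) : ULift.{u} Bool) = ⟨true⟩} :=
      { default := ⟨i, by simp⟩
        uniq := fun j => by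
          have := j.2
          simp only [ULift.up.injEq, decide_eq_true_eq] at this
          exact Subtype.ext this }
    rw [isum_unique]; rfl
  rw [this]
  exact natLE_add_left _ _

end order

/-! ### Products and function semimodules -/

instance piCompleteMonoid (A : Type) (S : A → Type u) [∀ a, AddCommMonoid (S a)]
    [∀ a, CompleteMonoid (S a)] : CompleteMonoid (∀ a, S a) where
  isum f := fun a => isum (fun i => f i a)
  isum_empty f := by funext a; exact isum_empty _
  isum_unique f := by funext a; exact isum_unique _
  isum_pair f := by funext a; exact isum_pair _
  isum_partition π f := by funext a; exact isum_partition π (fun i => f i a)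

instance piIdemContinuous (A : Type) (S : A → Type u) [∀ a, AddCommMonoid (S a)]
    [∀ a, CompleteMonoid (S a)] [∀ a, IdemContinuous (S a)] : IdemContinuous (∀ a, S a) where
  add_self f := by funext a; exact IdemContinuous.add_self _
  isum_le_of_finite f c h := by
    funext a
    refine IdemContinuous.isum_le_of_finite (fun i => f i a) (c a) fun F => ?_
    have := congrFun (h F) a
    simpa [NatLE] using this

instance funCompleteModule (A : Type) (S : Type u) [Semiring S] [CompleteMonoid S]
    [CompleteSemiring S] : CompleteModule S (A → S) where
  smul_isum s I f := by funext a; exact CompleteSemiring.mul_isum s _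

instance funCompleteModuleOp (A : Type) (S : Type u) [Semiring S] [CompleteMonoid S]
    [CompleteSemiring S] : CompleteModule Sᵐᵒᵖ (A → S) where
  smul_isum s I f := by funext a; exact CompleteSemiring.isum_mul s.unop _

/-! ### The complete tensor product -/

section tensor

variable (S : Type u) {M N : Type u} [Semiring S] [AddCommMonoid M] [AddCommMonoid N]
  [Module Sᵐᵒᵖ M] [Module S N] [CompleteMonoid M] [CompleteMonoid N]

/-- A function `f : M × N → 𝔹`, given by its support, is a tensor. The right action of `s` on `m`
is `op s • m`. The sums are over all `m'` with `f (m', n) = 1`, resp. all `n'` with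
`f (m, n') = 1`. -/
structure IsTensor (f : Set (M × N)) : Prop where
  zero_mem : ((0 : M), (0 : N)) ∈ f
  smul_mem_iff : ∀ (m : M) (s : S) (n : N), (op s • m, n) ∈ f ↔ (m, s • n) ∈ f
  left_mem : ∀ (m : M) (n : N),
    NatLE m (isum (fun m' : {m' : M // (m', n) ∈ f} => (m' : M))) → (m, n) ∈ f
  right_mem : ∀ (m : M) (n : N),
    NatLE n (isum (fun n' : {n' : N // (m, n') ∈ f} => (n' : N))) → (m, n) ∈ f

variable (M N) in
/-- The complete tensor product `M ⊗̂_S N`: the set of all tensors. -/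
def TensorHat : Type u := {f : Set (M × N) // IsTensor S f}

variable {S}

theorem IsTensor.isum_left [IdemContinuous M] {f : Set (M × N)} (hf : IsTensor S f)
    {I : Type u} {m : I → M} {n : N} (h : ∀ i, (m i, n) ∈ f) : (isum m, n) ∈ f :=
  hf.left_mem _ _ (isum_le fun i => le_isum (fun m' : {m' : M // (m', n) ∈ f} => (m' : M))
    ⟨m i, h i⟩)

theorem IsTensor.isum_right [IdemContinuous N] {f : Set (M × N)} (hf : IsTensor S f)
    {I : Type u} {m : M} {n : I → N} (h : ∀ i, (m, n i) ∈ f) : (m, isum n) ∈ f :=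
  hf.right_mem _ _ (isum_le fun i => le_isum (fun n' : {n' : N // (m, n') ∈ f} => (n' : N))
    ⟨n i, h i⟩)

theorem IsTensor.mono_left [IdemContinuous M] {f : Set (M × N)} (hf : IsTensor S f)
    {m m' : M} {n : N} (h : NatLE m m') (h' : (m', n) ∈ f) : (m, n) ∈ f :=
  hf.left_mem _ _ (h.trans (le_isum (fun m' : {m' : M // (m', n) ∈ f} => (m' : M)) ⟨m', h'⟩))

theorem IsTensor.mono_right [IdemContinuous N] {f : Set (M × N)} (hf : IsTensor S f)
    {m : M} {n n' : N} (h : NatLE n n') (h' : (m, n') ∈ f) : (m, n) ∈ f :=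
  hf.right_mem _ _ (h.trans (le_isum (fun n' : {n' : N // (m, n') ∈ f} => (n' : N)) ⟨n', h'⟩))

theorem IsTensor.zero_left {f : Set (M × N)} (hf : IsTensor S f) (n : N) : ((0 : M), n) ∈ f :=
  hf.left_mem _ _ (natLE_zero _)

theorem IsTensor.zero_right {f : Set (M × N)} (hf : IsTensor S f) (m : M) : (m, (0 : N)) ∈ f :=
  hf.right_mem _ _ (natLE_zero _)

theorem IsTensor.add_left [IdemContinuous M] {f : Set (M × N)} (hf : IsTensor S f)
    {m m' : M} {n : N} (h : (m, n) ∈ f) (h' : (m', n) ∈ f) : (m + m', n) ∈ f := by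
  have := hf.isum_left (m := fun b : ULift.{u} Bool => if b.down then m else m') (n := n)
    (by rintro ⟨_ | _⟩ <;> simpa)
  rw [isum_pair] at this
  simpa using this

theorem IsTensor.add_right [IdemContinuous N] {f : Set (M × N)} (hf : IsTensor S f)
    {m : M} {n n' : N} (h : (m, n) ∈ f) (h' : (m, n') ∈ f) : (m, n + n') ∈ f := by
  have := hf.isum_right (n := fun b : ULift.{u} Bool => if b.down then n else n') (m := m)
    (by rintro ⟨_ | _⟩ <;> simpa)
  rw [isum_pair] at this
  simpa using this

variable [IdemContinuous M] [IdemContinuous N]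

theorem IsTensor.sInter {C : Set (Set (M × N))} (hC : ∀ g ∈ C, IsTensor S g) :
    IsTensor S (⋂₀ C) where
  zero_mem g hg := (hC g hg).zero_mem
  smul_mem_iff m s n := by
    simp only [Set.mem_sInter]
    exact forall₂_congr fun g hg => (hC g hg).smul_mem_iff m s n
  left_mem m n h g hg :=
    (hC g hg).mono_left h ((hC g hg).isum_left fun i => i.2 g hg)
  right_mem m n h g hg :=
    (hC g hg).mono_right h ((hC g hg).isum_right fun i => i.2 g hg)

namespace TensorHat

/-- The tensor `f^⊗` generated by a function `f : M × N → 𝔹` (given by its support). -/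
def gen (S : Type u) [Semiring S] [Module Sᵐᵒᵖ M] [Module S N] (f : Set (M × N)) :
    TensorHat S M N :=
  ⟨⋂₀ {g | IsTensor S g ∧ f ⊆ g}, IsTensor.sInter fun _ h => h.1⟩

theorem subset_gen (f : Set (M × N)) : f ⊆ (gen S f).1 := fun _ hx _ hg => hg.2 hx

theorem gen_subset {f : Set (M × N)} {g : TensorHat S M N} (h : f ⊆ g.1) : (gen S f).1 ⊆ g.1 :=
  fun _ hx => hx g.1 ⟨g.2, h⟩

theorem gen_coe (f : TensorHat S M N) : gen S f.1 = f :=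
  Subtype.ext ((gen_subset subset_rfl).antisymm (subset_gen _))

theorem gen_mono {f g : Set (M × N)} (h : f ⊆ g) : (gen S f).1 ⊆ (gen S g).1 :=
  gen_subset (h.trans (subset_gen g))

theorem gen_eq_gen {f g : Set (M × N)} (h₁ : f ⊆ (gen S g).1) (h₂ : g ⊆ (gen S f).1) :
    gen S f = gen S g :=
  Subtype.ext ((gen_subset h₁).antisymm (gen_subset h₂))

theorem gen_iUnion_gen {I : Sort*} (f : I → Set (M × N)) :
    gen S (⋃ i, (gen S (f i)).1) = gen S (⋃ i, f i) :=
  gen_eq_gen (Set.iUnion_subset fun i => gen_mono (Set.subset_iUnion f i))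
    (Set.iUnion_subset fun i => ((subset_gen (f i)).trans
      (Set.subset_iUnion (fun i => (gen S (f i)).1) i)).trans (subset_gen _))

theorem gen_union_gen (f g : Set (M × N)) :
    gen S ((gen S f).1 ∪ (gen S g).1) = gen S (f ∪ g) :=
  gen_eq_gen (Set.union_subset (gen_mono Set.subset_union_left)
      (gen_mono Set.subset_union_right))
    ((Set.union_subset_union (subset_gen f) (subset_gen g)).trans (subset_gen _))

theorem gen_gen_union (f g : Set (M × N)) : gen S ((gen S f).1 ∪ g) = gen S (f ∪ g) :=
  gen_eq_gen (Set.union_subset (gen_mono Set.subset_union_left)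
      (Set.subset_union_right.trans (subset_gen _)))
    ((Set.union_subset_union (subset_gen f) subset_rfl).trans (subset_gen _))

instance : AddCommMonoid (TensorHat S M N) where
  add f g := gen S (f.1 ∪ g.1)
  zero := gen S ∅
  add_assoc f g h := by
    change gen S ((gen S (f.1 ∪ g.1)).1 ∪ h.1) = gen S (f.1 ∪ (gen S (g.1 ∪ h.1)).1)
    rw [gen_gen_union, Set.union_comm f.1 (gen S _).1, gen_gen_union, Set.union_assoc,
      Set.union_comm (g.1 ∪ h.1)]
  zero_add f := by
    change gen S ((gen S ∅).1 ∪ f.1) = f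
    rw [gen_gen_union, Set.empty_union, gen_coe]
  add_zero f := by
    change gen S (f.1 ∪ (gen S ∅).1) = f
    rw [Set.union_comm, gen_gen_union, Set.empty_union, gen_coe]
  add_comm f g := by
    change gen S (f.1 ∪ g.1) = gen S (g.1 ∪ f.1)
    rw [Set.union_comm]
  nsmul := @nsmulRec _ ⟨gen S ∅⟩ ⟨fun f g => gen S (f.1 ∪ g.1)⟩

theorem add_def (f g : TensorHat S M N) : f + g = gen S (f.1 ∪ g.1) := rfl

theorem zero_def : (0 : TensorHat S M N) = gen S ∅ := rfl

theorem natLE_iff (f g : TensorHat S M N) : NatLE f g ↔ f.1 ⊆ g.1 := by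
  constructor
  · intro h
    rw [← h, add_def]
    exact Set.subset_union_left.trans (subset_gen _)
  · intro h
    unfold NatLE
    rw [add_def, Set.union_eq_self_of_subset_left h, gen_coe]

/-- The summation law `⨁ f_i = (∑ f_i)^⊗`. -/
instance : CompleteMonoid (TensorHat S M N) where
  isum f := gen S (⋃ i, (f i).1)
  isum_empty f := by rw [Set.iUnion_of_empty]; rfl
  isum_unique f := by
    have : (⋃ i, (f i).1) = (f default).1 := iSup_unique _
    rw [this, gen_coe]
  isum_pair f := by
    rw [add_def]
    congr 1
    ext x
    simp only [Set.mem_iUnion, Set.mem_union, ULift.exists, Bool.exists_bool]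
    tauto
  isum_partition π f := by
    rw [gen_iUnion_gen]
    congr 1
    ext x
    simp

theorem isum_def {I : Type u} (f : I → TensorHat S M N) :
    isum f = gen S (⋃ i, (f i).1) := rfl

instance : IdemContinuous (TensorHat S M N) where
  add_self f := by rw [add_def, Set.union_self, gen_coe]
  isum_le_of_finite f c h := by
    rw [natLE_iff, isum_def]
    refine gen_subset (Set.iUnion_subset fun i => ?_)
    have := h {i}
    rwa [Finset.sum_singleton, natLE_iff] at this

/-- The elementary tensor `m ⊗̂ n`. -/
def tmul (S : Type u) [Semiring S] [Module Sᵐᵒᵖ M] [Module S N] (m : M) (n : N) :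
    TensorHat S M N := gen S {(m, n)}

section left

variable [Module S M] [SMulCommClass S Sᵐᵒᵖ M] [CompleteModule S M]

theorem isTensor_left (r : S) {g : Set (M × N)} (hg : IsTensor S g) :
    IsTensor S {x : M × N | (r • x.1, x.2) ∈ g} where
  zero_mem := by simpa using hg.zero_mem
  smul_mem_iff m s n := by
    simp only [Set.mem_ofPred_eq]
    rw [smul_comm]
    exact hg.smul_mem_iff _ _ _
  left_mem m n h := by
    simp only [Set.mem_ofPred_eq] at h ⊢
    have h' := congrArg (fun y => r • y) h
    simp only [smul_add] at h'
    refine hg.mono_left h' ?_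
    rw [CompleteModule.smul_isum]
    exact hg.isum_left fun i => i.2
  right_mem m n h := hg.right_mem _ _ h

theorem gen_left_gen (r : S) (f : Set (M × N)) :
    gen S ((fun x : M × N => (r • x.1, x.2)) '' (gen S f).1) =
      gen S ((fun x : M × N => (r • x.1, x.2)) '' f) := by
  refine gen_eq_gen ?_ ((Set.image_mono (subset_gen f)).trans (subset_gen _))
  rintro _ ⟨x, hx, rfl⟩
  exact hx _ ⟨isTensor_left r (gen S ((fun x : M × N => (r • x.1, x.2)) '' f)).2,
    fun y hy => subset_gen _ ⟨y, hy, rfl⟩⟩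

/-- The left scalar multiplication: the continuous additive extension of
`r • (m ⊗̂ n) = (r m) ⊗̂ n`, that is, `r • f = ⨁_{(m, n) ∈ supp f} (r m) ⊗̂ n`. -/
instance : Module S (TensorHat S M N) where
  smul r f := gen S ((fun x : M × N => (r • x.1, x.2)) '' f.1)
  one_smul f := by
    change gen S ((fun x : M × N => ((1 : S) • x.1, x.2)) '' f.1) = f
    simp [gen_coe]
  mul_smul r s f := by
    change gen S ((fun x : M × N => ((r * s) • x.1, x.2)) '' f.1) =
      gen S ((fun x : M × N => (r • x.1, x.2)) ''
        (gen S ((fun x : M × N => (s • x.1, x.2)) '' f.1)).1)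
    rw [gen_left_gen, Set.image_image]
    simp [mul_smul]
  smul_zero r := by
    change gen S ((fun x : M × N => (r • x.1, x.2)) '' (gen S ∅).1) = gen S ∅
    rw [gen_left_gen, Set.image_empty]
  smul_add r f g := by
    change gen S ((fun x : M × N => (r • x.1, x.2)) '' (gen S (f.1 ∪ g.1)).1) =
      gen S ((gen S ((fun x : M × N => (r • x.1, x.2)) '' f.1)).1 ∪
        (gen S ((fun x : M × N => (r • x.1, x.2)) '' g.1)).1)
    rw [gen_left_gen, gen_union_gen, Set.image_union]
  add_smul r s f := by
    change gen S ((fun x : M × N => ((r + s) • x.1, x.2)) '' f.1) =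
      gen S ((gen S ((fun x : M × N => (r • x.1, x.2)) '' f.1)).1 ∪
        (gen S ((fun x : M × N => (s • x.1, x.2)) '' f.1)).1)
    rw [gen_union_gen]
    apply gen_eq_gen
    · rintro _ ⟨x, hx, rfl⟩
      simp only [add_smul]
      exact (gen S _).2.add_left (subset_gen _ (Or.inl ⟨x, hx, rfl⟩))
        (subset_gen _ (Or.inr ⟨x, hx, rfl⟩))
    · rintro _ (⟨x, hx, rfl⟩ | ⟨x, hx, rfl⟩)
      · refine (gen S _).2.mono_left (natLE_add_left (r • x.1) (s • x.1))
          (subset_gen _ ⟨x, hx, by simp only [add_smul]⟩)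
      · refine (gen S _).2.mono_left (natLE_add_right (r • x.1) (s • x.1))
          (subset_gen _ ⟨x, hx, by simp only [add_smul]⟩)
  zero_smul f := by
    change gen S ((fun x : M × N => ((0 : S) • x.1, x.2)) '' f.1) = gen S ∅
    apply gen_eq_gen
    · rintro _ ⟨x, hx, rfl⟩
      simp only [zero_smul]
      exact (gen S _).2.zero_left _
    · exact Set.empty_subset _

end left

section right

variable [Module Sᵐᵒᵖ N] [SMulCommClass S Sᵐᵒᵖ N] [CompleteModule Sᵐᵒᵖ N]

theorem isTensor_right (t : Sᵐᵒᵖ) {g : Set (M × N)} (hg : IsTensor S g) :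
    IsTensor S {x : M × N | (x.1, t • x.2) ∈ g} where
  zero_mem := by simpa using hg.zero_mem
  smul_mem_iff m s n := by
    simp only [Set.mem_ofPred_eq]
    rw [← smul_comm s t n]
    exact hg.smul_mem_iff _ _ _
  left_mem m n h := hg.left_mem _ _ h
  right_mem m n h := by
    simp only [Set.mem_ofPred_eq] at h ⊢
    have h' := congrArg (fun y => t • y) h
    simp only [smul_add] at h'
    refine hg.mono_right h' ?_
    rw [CompleteModule.smul_isum]
    exact hg.isum_right fun i => i.2

theorem gen_right_gen (t : Sᵐᵒᵖ) (f : Set (M × N)) :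
    gen S ((fun x : M × N => (x.1, t • x.2)) '' (gen S f).1) =
      gen S ((fun x : M × N => (x.1, t • x.2)) '' f) := by
  refine gen_eq_gen ?_ ((Set.image_mono (subset_gen f)).trans (subset_gen _))
  rintro _ ⟨x, hx, rfl⟩
  exact hx _ ⟨isTensor_right t (gen S ((fun x : M × N => (x.1, t • x.2)) '' f)).2,
    fun y hy => subset_gen _ ⟨y, hy, rfl⟩⟩

/-- The right scalar multiplication: the continuous additive extension of
`(m ⊗̂ n) t = m ⊗̂ (n t)`. -/
instance : Module Sᵐᵒᵖ (TensorHat S M N) where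
  smul t f := gen S ((fun x : M × N => (x.1, t • x.2)) '' f.1)
  one_smul f := by
    change gen S ((fun x : M × N => (x.1, (1 : Sᵐᵒᵖ) • x.2)) '' f.1) = f
    simp [gen_coe]
  mul_smul r s f := by
    change gen S ((fun x : M × N => (x.1, (r * s) • x.2)) '' f.1) =
      gen S ((fun x : M × N => (x.1, r • x.2)) ''
        (gen S ((fun x : M × N => (x.1, s • x.2)) '' f.1)).1)
    rw [gen_right_gen, Set.image_image]
    simp [mul_smul]
  smul_zero r := by
    change gen S ((fun x : M × N => (x.1, r • x.2)) '' (gen S ∅).1) = gen S ∅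
    rw [gen_right_gen, Set.image_empty]
  smul_add r f g := by
    change gen S ((fun x : M × N => (x.1, r • x.2)) '' (gen S (f.1 ∪ g.1)).1) =
      gen S ((gen S ((fun x : M × N => (x.1, r • x.2)) '' f.1)).1 ∪
        (gen S ((fun x : M × N => (x.1, r • x.2)) '' g.1)).1)
    rw [gen_right_gen, gen_union_gen, Set.image_union]
  add_smul r s f := by
    change gen S ((fun x : M × N => (x.1, (r + s) • x.2)) '' f.1) =
      gen S ((gen S ((fun x : M × N => (x.1, r • x.2)) '' f.1)).1 ∪
        (gen S ((fun x : M × N => (x.1, s • x.2)) '' f.1)).1)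
    rw [gen_union_gen]
    apply gen_eq_gen
    · rintro _ ⟨x, hx, rfl⟩
      simp only [add_smul]
      exact (gen S _).2.add_right (subset_gen _ (Or.inl ⟨x, hx, rfl⟩))
        (subset_gen _ (Or.inr ⟨x, hx, rfl⟩))
    · rintro _ (⟨x, hx, rfl⟩ | ⟨x, hx, rfl⟩)
      · refine (gen S _).2.mono_right (natLE_add_left (r • x.2) (s • x.2))
          (subset_gen _ ⟨x, hx, by simp only [add_smul]⟩)
      · refine (gen S _).2.mono_right (natLE_add_right (r • x.2) (s • x.2))
          (subset_gen _ ⟨x, hx, by simp only [add_smul]⟩)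
  zero_smul f := by
    change gen S ((fun x : M × N => (x.1, (0 : Sᵐᵒᵖ) • x.2)) '' f.1) = gen S ∅
    apply gen_eq_gen
    · rintro _ ⟨x, hx, rfl⟩
      simp only [zero_smul]
      exact (gen S _).2.zero_right _
    · exact Set.empty_subset _

end right

instance [Module S M] [SMulCommClass S Sᵐᵒᵖ M] [CompleteModule S M]
    [Module Sᵐᵒᵖ N] [SMulCommClass S Sᵐᵒᵖ N] [CompleteModule Sᵐᵒᵖ N] :
    SMulCommClass S Sᵐᵒᵖ (TensorHat S M N) where
  smul_comm r t f := by
    change gen S ((fun x : M × N => (r • x.1, x.2)) ''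
        (gen S ((fun x : M × N => (x.1, t • x.2)) '' f.1)).1) =
      gen S ((fun x : M × N => (x.1, t • x.2)) ''
        (gen S ((fun x : M × N => (r • x.1, x.2)) '' f.1)).1)
    rw [gen_left_gen, gen_right_gen, Set.image_image, Set.image_image]

end TensorHat

end tensor

/-! ### The Brauer category -/

/-- A Brauer diagram without loops on the point set `X`: a fixed point free involution pairing
each point with the other end of its arc. -/
structure Pairing (X : Type) where
  arc : X → X
  arc_arc : ∀ x, arc (arc x) = x
  arc_ne : ∀ x, arc x ≠ x

namespace Pairing

variable {X Y : Type}

@[ext] theorem ext {σ τ : Pairing X} (h : ∀ x, σ.arc x = τ.arc x) : σ = τ := by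
  cases σ; cases τ; congr; exact funext h

instance [Finite X] : Finite (Pairing X) :=
  Finite.of_injective Pairing.arc fun _ _ h => Pairing.ext (congrFun h)

def map (e : X ≃ Y) (σ : Pairing X) : Pairing Y where
  arc y := e (σ.arc (e.symm y))
  arc_arc y := by simp [σ.arc_arc]
  arc_ne y h := σ.arc_ne (e.symm y) ((e.eq_symm_apply).2 h)

def sum (σ : Pairing X) (τ : Pairing Y) : Pairing (X ⊕ Y) where
  arc := Sum.map σ.arc τ.arc
  arc_arc := by rintro (x | y) <;> simp [σ.arc_arc, τ.arc_arc]
  arc_ne := by rintro (x | y) <;> simp [σ.arc_ne, τ.arc_ne]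

/-- Glue the points `none` and `some none`: their arcs are joined to a single arc (if they are the
two ends of one arc, then this arc closes up to a loop and disappears). -/
def glueArc (σ : Pairing (Option (Option X))) (x : X) : X :=
  match σ.arc (some (some x)) with
  | some (some y) => y
  | none => ((σ.arc (some none)).getD none).getD x
  | some none => ((σ.arc none).getD none).getD x

def glue (σ : Pairing (Option (Option X))) : Pairing X where
  arc := σ.glueArc
  arc_arc x := by
    unfold glueArc
    have h0 := σ.arc_arc (some (some x))
    have h1 := σ.arc_arc none
    have h2 := σ.arc_arc (some none)
    have h3 := σ.arc_ne none
    have h4 := σ.arc_ne (some none)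
    rcases h : σ.arc (some (some x)) with _ | _ | y <;> rw [h] at h0
    · rcases h' : σ.arc (some none) with _ | _ | z
      · rw [h'] at h2; rw [h2] at h0; simp at h0
      · exact absurd h' h4
      · rw [h'] at h2; simp [h2, h0]
    · rcases h' : σ.arc none with _ | _ | z
      · exact absurd h' h3
      · rw [h'] at h1; rw [h1] at h0; simp at h0
      · rw [h'] at h1; simp [h1, h0]
    · simp [h0]
  arc_ne x hx := by
    unfold glueArc at hx
    have h0 := σ.arc_arc (some (some x))
    have h1 := σ.arc_arc none
    have h2 := σ.arc_arc (some none)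
    have h3 := σ.arc_ne none
    have h4 := σ.arc_ne (some none)
    rcases h : σ.arc (some (some x)) with _ | _ | y <;> rw [h] at h0 hx
    · rcases h' : σ.arc (some none) with _ | _ | z
      · rw [h'] at h2; rw [h2] at h0; simp at h0
      · exact absurd h' h4
      · rw [h'] at h2 hx; simp at hx; subst hx; rw [h2] at h; simp at h
    · rcases h' : σ.arc none with _ | _ | z
      · exact absurd h' h3
      · rw [h'] at h1; rw [h1] at h0; simp at h0
      · rw [h'] at h1 hx; simp at hx; subst hx; rw [h1] at h; simp at h
    · simp at hx; subst hx; exact σ.arc_ne _ h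

open Classical in
/-- The number of loops created by `glue`. -/
def glueLoops (σ : Pairing (Option (Option X))) : ℕ := if σ.arc none = some none then 1 else 0

/-- Separate the first points of both copies of `Fin (p + 1)`. -/
def peel (X : Type) (p : ℕ) :
    X ⊕ (Fin (p + 1) ⊕ Fin (p + 1)) ≃ Option (Option (X ⊕ (Fin p ⊕ Fin p))) where
  toFun
    | .inl x => some (some (.inl x))
    | .inr (.inl k) => Fin.cases none (fun k => some (some (.inr (.inl k)))) k
    | .inr (.inr k) => Fin.cases (some none) (fun k => some (some (.inr (.inr k)))) k
  invFun
    | none => .inr (.inl 0)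
    | some none => .inr (.inr 0)
    | some (some (.inl x)) => .inl x
    | some (some (.inr (.inl k))) => .inr (.inl k.succ)
    | some (some (.inr (.inr k))) => .inr (.inr k.succ)
  left_inv := by
    rintro (x | k | k)
    · rfl
    · induction k using Fin.cases <;> rfl
    · induction k using Fin.cases <;> rfl
  right_inv := by rintro (_ | _ | x | k | k) <;> rfl

/-- Glue the two copies of `Fin p` pointwise; the second component counts the loops created. -/
def glueAll : (p : ℕ) → Pairing (X ⊕ (Fin p ⊕ Fin p)) → Pairing X × ℕ
  | 0, σ => (σ.map (Equiv.sumEmpty X (Fin 0 ⊕ Fin 0)), 0)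
  | p + 1, σ =>
    ((glueAll p (σ.map (peel X p)).glue).1,
      (glueAll p (σ.map (peel X p)).glue).2 + (σ.map (peel X p)).glueLoops)

end Pairing

/-- A morphism `[m] → [n]` of the Brauer category: an arc diagram on the `m` incoming points
and `n` outgoing points together with a number of loops. -/
structure BrHom (m n : ℕ) where
  pairing : Pairing (Fin m ⊕ Fin n)
  loops : ℕ

namespace BrHom

/-- The identity `1_{[m]}`. -/
def id (m : ℕ) : BrHom m m where
  pairing := ⟨Sum.swap, by simp, by rintro (x | x) <;> simp⟩
  loops := 0

/-- The composition `ψ ∘ φ`: glue the outgoing points of `φ` to the incoming points of `ψ`. -/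
def comp {m p n : ℕ} (ψ : BrHom p n) (φ : BrHom m p) : BrHom m n where
  pairing := (Pairing.glueAll p ((φ.pairing.sum ψ.pairing).map
    ((Equiv.sumCongr (Equiv.refl _) (Equiv.sumComm _ _)).trans
      (Equiv.sumSumSumComm (Fin m) (Fin p) (Fin n) (Fin p))))).1
  loops := φ.loops + ψ.loops + (Pairing.glueAll p ((φ.pairing.sum ψ.pairing).map
    ((Equiv.sumCongr (Equiv.refl _) (Equiv.sumComm _ _)).trans
      (Equiv.sumSumSumComm (Fin m) (Fin p) (Fin n) (Fin p))))).2

/-- The tensor product `φ ⊗ φ'`: stack `φ'` on top of `φ`. -/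
def tensor {m n m' n' : ℕ} (φ : BrHom m n) (φ' : BrHom m' n') : BrHom (m + m') (n + n') where
  pairing := (φ.pairing.sum φ'.pairing).map
    ((Equiv.sumSumSumComm (Fin m) (Fin n) (Fin m') (Fin n')).trans
      (Equiv.sumCongr finSumFinEquiv finSumFinEquiv))
  loops := φ.loops + φ'.loops

end BrHom

/-- The morphisms of the Brauer category. -/
structure BrMor where
  dom : ℕ
  cod : ℕ
  hom : BrHom dom cod

namespace BrMor

def one (m : ℕ) : BrMor := ⟨m, m, BrHom.id m⟩

def tensor (φ φ' : BrMor) : BrMor := ⟨φ.dom + φ'.dom, φ.cod + φ'.cod, φ.hom.tensor φ'.hom⟩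

def IsIdentity (φ : BrMor) : Prop := ∃ m, φ = one m

/-- `φ 0 ⊗ φ 1 ⊗ ⋯ ⊗ φ (K - 1)`. -/
def tensorUpTo (φ : ℕ → BrMor) : ℕ → BrMor
  | 0 => one 0
  | K + 1 => (tensorUpTo φ K).tensor (φ K)

end BrMor

/-! ### Duality structures and the representation of the Brauer category -/

/-- A duality structure `(i, e)` on a real vector space. -/
structure DualityStructure (V : Type u) [AddCommGroup V] [Module ℝ V] where
  unit : ℝ →ₗ[ℝ] V ⊗[ℝ] V
  counit : V ⊗[ℝ] V →ₗ[ℝ] ℝ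
  unit_symm : (TensorProduct.comm ℝ V V).toLinearMap ∘ₗ unit = unit
  counit_symm : counit ∘ₗ (TensorProduct.comm ℝ V V).toLinearMap = counit
  zigzag : (TensorProduct.lid ℝ V).toLinearMap ∘ₗ counit.rTensor V ∘ₗ
    (TensorProduct.assoc ℝ V V V).symm.toLinearMap ∘ₗ unit.lTensor V ∘ₗ
    (TensorProduct.rid ℝ V).symm.toLinearMap = LinearMap.id

namespace DualityStructure

variable {V : Type u} [AddCommGroup V] [Module ℝ V] (𝔡 : DualityStructure V)

/-- The trace of `(i, e)`, i.e. the value of the loop. -/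
def trace : ℝ := 𝔡.counit (𝔡.unit 1)

/-- Index set of the standard basis of `V`. -/
abbrev Idx (V : Type u) [AddCommGroup V] [Module ℝ V] : Type := Fin (Module.finrank ℝ V)

section

variable [FiniteDimensional ℝ V]

variable (V) in
abbrev basis : Module.Basis (Idx V) ℝ V := Module.finBasis ℝ V

/-- The matrix of `e`. -/
def eMat (a b : Idx V) : ℝ := 𝔡.counit (basis V a ⊗ₜ basis V b)

/-- The matrix of `i`. -/
def iMat (a b : Idx V) : ℝ := ((basis V).tensorProduct (basis V)).repr (𝔡.unit 1) (a, b)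

theorem eMat_symm (a b : Idx V) : 𝔡.eMat a b = 𝔡.eMat b a := by
  unfold eMat
  conv_lhs => rw [← 𝔡.counit_symm]
  simp

theorem unit_one : 𝔡.unit 1 = ∑ a, ∑ b, 𝔡.iMat a b • (basis V a ⊗ₜ[ℝ] basis V b) := by
  conv_lhs => rw [← ((basis V).tensorProduct (basis V)).sum_repr (𝔡.unit 1)]
  rw [Fintype.sum_prod_type]
  simp [iMat]

theorem iMat_symm (a b : Idx V) : 𝔡.iMat a b = 𝔡.iMat b a := by
  have h := congrArg (fun f => f 1) 𝔡.unit_symm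
  simp only [LinearMap.comp_apply, LinearEquiv.coe_coe] at h
  have h2 : ∀ x : V ⊗[ℝ] V, ((basis V).tensorProduct (basis V)).repr
      (TensorProduct.comm ℝ V V x) (a, b) =
      ((basis V).tensorProduct (basis V)).repr x (b, a) := by
    intro x
    induction x using TensorProduct.induction_on with
    | zero => simp
    | tmul x y => simp [mul_comm]
    | add x y hx hy => simp [hx, hy]
  unfold iMat
  rw [← h2, h]

theorem eMat_iMat (a c : Idx V) :
    ∑ b, 𝔡.eMat a b * 𝔡.iMat b c = if a = c then 1 else 0 := by
  have h := congrArg (fun f => (basis V).repr (f (basis V a)) c) 𝔡.zigzag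
  simp only [LinearMap.comp_apply, LinearEquiv.coe_coe, LinearMap.id_apply,
    TensorProduct.rid_symm_apply, LinearMap.lTensor_tmul, unit_one, TensorProduct.tmul_sum,
    TensorProduct.tmul_smul, map_sum, map_smul, TensorProduct.assoc_symm_tmul,
    LinearMap.rTensor_tmul, TensorProduct.lid_tmul, Module.Basis.repr_self,
    Finsupp.coe_finsetSum, Finset.sum_apply, Finsupp.smul_apply, Finsupp.single_apply,
    smul_eq_mul, mul_ite, mul_one, mul_zero, Finset.sum_ite_eq', Finset.mem_univ, if_true] at h
  rw [← h]
  exact Finset.sum_congr rfl fun b _ => mul_comm _ _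

theorem trace_eq : 𝔡.trace = Module.finrank ℝ V := by
  unfold trace
  rw [unit_one, map_sum]
  have : ∀ a, 𝔡.counit (∑ b, 𝔡.iMat a b • (basis V a ⊗ₜ[ℝ] basis V b)) = 1 := fun a => by
    have := 𝔡.eMat_iMat a a
    rw [if_pos rfl] at this
    rw [← this, map_sum]
    exact Finset.sum_congr rfl fun b _ => by
      rw [map_smul, smul_eq_mul, mul_comm, 𝔡.iMat_symm]; rfl
  simp [this]

/-- The weight of an arc. The ends of the arc are labelled by a basis index and by whether they
are outgoing (`true`) or incoming (`false`). -/
def weight : Sym2 (Bool × Idx V) → ℝ :=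
  Sym2.lift ⟨fun x y => match x, y with
    | (false, a), (false, b) => 𝔡.eMat a b
    | (true, a), (true, b) => 𝔡.iMat a b
    | (_, a), (_, b) => if a = b then 1 else 0, by
    rintro ⟨_ | _, a⟩ ⟨_ | _, b⟩
    · exact 𝔡.eMat_symm a b
    · simp [eq_comm]
    · simp [eq_comm]
    · exact 𝔡.iMat_symm a b⟩

end

end DualityStructure

namespace Pairing

variable {X Y L : Type} [Fintype X] [Fintype Y]

open Classical in
/-- The set of arcs. -/
def arcs (σ : Pairing X) : Finset (Sym2 X) := Finset.univ.image fun x => s(x, σ.arc x)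

theorem mk_mem_arcs (σ : Pairing X) (x y : X) : s(x, y) ∈ σ.arcs ↔ σ.arc x = y := by
  simp only [arcs, Finset.mem_image, Finset.mem_univ, true_and, Sym2.eq_iff]
  constructor
  · rintro ⟨z, ⟨rfl, rfl⟩ | ⟨rfl, h⟩⟩
    · rfl
    · rw [← h, σ.arc_arc]
  · rintro rfl
    exact ⟨x, Or.inl ⟨rfl, rfl⟩⟩

/-- The product over all arcs of the weights of the labels of their ends. -/
def prodWeight (σ : Pairing X) (W : Sym2 L → ℝ) (l : X → L) : ℝ := ∏ z ∈ σ.arcs, W (z.map l)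

theorem prodWeight_map (e : X ≃ Y) (σ : Pairing X) (W : Sym2 L → ℝ) (l : Y → L) :
    (σ.map e).prodWeight W l = σ.prodWeight W (l ∘ e) := by
  classical
  have : (σ.map e).arcs = σ.arcs.image (Sym2.map e) := by
    ext z
    induction z using Sym2.ind with | _ x y =>
    rw [mk_mem_arcs, Finset.mem_image]
    constructor
    · intro h
      refine ⟨s(e.symm x, e.symm y), ?_, by simp⟩
      rw [mk_mem_arcs]
      exact (e.eq_symm_apply).2 h
    · rintro ⟨w, hw, h⟩
      induction w using Sym2.ind with | _ u v =>
      rw [mk_mem_arcs] at hw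
      rw [Sym2.map_mk, Sym2.eq_iff] at h
      rcases h with ⟨rfl, rfl⟩ | ⟨rfl, rfl⟩
      · simp [map, hw]
      · simp [map, ← hw, σ.arc_arc]
  unfold prodWeight
  rw [this, Finset.prod_image fun a _ b _ h => Sym2.map.injective e.injective h]
  simp [Sym2.map_map]

theorem prodWeight_sum (σ : Pairing X) (τ : Pairing Y) (W : Sym2 L → ℝ) (l : X ⊕ Y → L) :
    (σ.sum τ).prodWeight W l =
      σ.prodWeight W (l ∘ Sum.inl) * τ.prodWeight W (l ∘ Sum.inr) := by
  classical
  have : (σ.sum τ).arcs = σ.arcs.image (Sym2.map Sum.inl) ∪ τ.arcs.image (Sym2.map Sum.inr) := by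
    ext z
    induction z using Sym2.ind with | _ x y =>
    rw [mk_mem_arcs]
    simp only [Finset.mem_union, Finset.mem_image]
    constructor
    · rintro rfl
      rcases x with x | x
      · exact Or.inl ⟨s(x, σ.arc x), (mk_mem_arcs _ _ _).2 rfl, rfl⟩
      · exact Or.inr ⟨s(x, τ.arc x), (mk_mem_arcs _ _ _).2 rfl, rfl⟩
    · rintro (⟨w, hw, h⟩ | ⟨w, hw, h⟩) <;> induction w using Sym2.ind with | _ u v =>
      rw [mk_mem_arcs] at hw
      rw [Sym2.map_mk, Sym2.eq_iff] at h
      rcases h with ⟨rfl, rfl⟩ | ⟨rfl, rfl⟩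
      · simp [sum, hw]
      · simp [sum, ← hw, arc_arc]
  unfold prodWeight
  rw [this, Finset.prod_union, Finset.prod_image, Finset.prod_image]
  · simp [Sym2.map_map]
  · exact fun a _ b _ h => Sym2.map.injective Sum.inr_injective h
  · exact fun a _ b _ h => Sym2.map.injective Sum.inl_injective h
  · rw [Finset.disjoint_left]
    intro z hz hz'
    rw [Finset.mem_image] at hz hz'
    obtain ⟨w, -, rfl⟩ := hz
    obtain ⟨w', -, h⟩ := hz'
    induction w using Sym2.ind with | _ u v =>
    induction w' using Sym2.ind with | _ u' v' =>
    simp at h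

/-- Label the two glued points by `a` and `b`. -/
def extLabel (l : X → L) (a b : L) : Option (Option X) → L
  | none => a
  | some none => b
  | some (some x) => l x

theorem prodWeight_glue (σ : Pairing (Option (Option X))) (W : Sym2 L → ℝ) (l : X → L)
    {ι : Type} [Fintype ι] (a b : ι → L) (t : ℝ)
    (hW : ∀ x y : L, ∑ i, W s(x, a i) * W s(b i, y) = W s(x, y))
    (ht : ∑ i, W s(a i, b i) = t) :
    ∑ i, σ.prodWeight W (extLabel l (a i) (b i)) = t ^ σ.glueLoops * σ.glue.prodWeight W l := by
  classical
  have h1 := σ.arc_arc none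
  have h2 := σ.arc_arc (some none)
  rcases h : σ.arc none with _ | _ | x
  · exact absurd h (σ.arc_ne _)
  · -- the two points are joined by an arc
    have hloops : σ.glueLoops = 1 := if_pos h
    have hg : ∀ x y, σ.glue.arc x = y ↔ σ.arc (some (some x)) = some (some y) := by
      intro x y
      have h0 := σ.arc_arc (some (some x))
      rw [h] at h1
      change σ.glueArc x = y ↔ _
      unfold glueArc
      rcases h' : σ.arc (some (some x)) with _ | _ | z <;> rw [h'] at h0
      · rw [h] at h0; simp at h0
      · rw [h1] at h0; simp at h0
      · simp
    have harcs : σ.arcs = insert s(none, some none)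
        (σ.glue.arcs.image (Sym2.map (fun x => some (some x)))) := by
      rw [h] at h1
      ext z
      induction z using Sym2.ind with | _ u v =>
      rw [mk_mem_arcs, Finset.mem_insert, Finset.mem_image]
      constructor
      · rintro rfl
        rcases u with _ | _ | u
        · left; rw [h]
        · left; rw [h1, Sym2.eq_swap]
        · right
          have h0 := σ.arc_arc (some (some u))
          rcases h' : σ.arc (some (some u)) with _ | _ | z <;> rw [h'] at h0
          · rw [h] at h0; simp at h0
          · rw [h1] at h0; simp at h0
          · exact ⟨s(u, z), by rw [mk_mem_arcs, hg, h'], by simp⟩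
      · rintro (h' | ⟨w, hw, h'⟩)
        · rw [Sym2.eq_iff] at h'
          rcases h' with ⟨rfl, rfl⟩ | ⟨rfl, rfl⟩
          · exact h
          · exact h1
        · induction w using Sym2.ind with | _ u' v' =>
          rw [mk_mem_arcs, hg] at hw
          rw [Sym2.map_mk, Sym2.eq_iff] at h'
          rcases h' with ⟨rfl, rfl⟩ | ⟨rfl, rfl⟩
          · exact hw
          · rw [← hw, σ.arc_arc]
    have hprod : ∀ i, σ.prodWeight W (extLabel l (a i) (b i)) =
        W s(a i, b i) * σ.glue.prodWeight W l := by
      intro i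
      unfold prodWeight
      rw [harcs, Finset.prod_insert, Finset.prod_image]
      · simp only [Sym2.map_map, Sym2.map_mk]
        rfl
      · exact fun u _ v _ h => Sym2.map.injective
          (fun p q h => by simpa using h) h
      · rw [Finset.mem_image]
        rintro ⟨w, -, hw⟩
        induction w using Sym2.ind with | _ u v =>
        simp at hw
    simp_rw [hprod]
    rw [← Finset.sum_mul, ht, hloops, pow_one]
  · -- two arcs are joined to one
    have hloops : σ.glueLoops = 0 := if_neg (by rw [h]; simp)
    rw [h] at h1
    obtain ⟨y, hy⟩ : ∃ y, σ.arc (some none) = some (some y) := by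
      rcases h' : σ.arc (some none) with _ | _ | y
      · rw [h', h] at h2; simp at h2
      · exact absurd h' (σ.arc_ne _)
      · exact ⟨y, rfl⟩
    rw [hy] at h2
    have hgx : σ.glue.arc x = y := by
      change σ.glueArc x = y
      unfold glueArc
      simp [h1, hy]
    have hgy : σ.glue.arc y = x := by
      change σ.glueArc y = x
      unfold glueArc
      simp [h2, h]
    have hxy : x ≠ y := by rw [← hgx]; exact (σ.glue.arc_ne x).symm
    have hg : ∀ u, u ≠ x → u ≠ y → ∀ v, σ.glue.arc u = v ↔
        σ.arc (some (some u)) = some (some v) := by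
      intro u hux huy v
      have h0 := σ.arc_arc (some (some u))
      change σ.glueArc u = v ↔ _
      unfold glueArc
      rcases h' : σ.arc (some (some u)) with _ | _ | z <;> rw [h'] at h0
      · rw [h] at h0; simp at h0; exact absurd h0.symm hux
      · rw [hy] at h0; simp at h0; exact absurd h0.symm huy
      · simp
    set R := σ.glue.arcs.erase s(x, y) with hR
    have hmemR : ∀ u v, s(u, v) ∈ R ↔ u ≠ x ∧ u ≠ y ∧ σ.arc (some (some u)) = some (some v) := by
      intro u v
      rw [hR, Finset.mem_erase, mk_mem_arcs]
      constructor
      · rintro ⟨hne, huv⟩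
        have hux : u ≠ x := by rintro rfl; rw [hgx] at huv; subst huv; exact hne rfl
        have huy : u ≠ y := by rintro rfl; rw [hgy] at huv; subst huv; exact hne Sym2.eq_swap
        exact ⟨hux, huy, (hg u hux huy v).1 huv⟩
      · rintro ⟨hux, huy, huv⟩
        refine ⟨?_, (hg u hux huy v).2 huv⟩
        rw [Ne, Sym2.eq_iff]
        rintro (⟨rfl, -⟩ | ⟨rfl, -⟩)
        · exact hux rfl
        · exact huy rfl
    have hgl : σ.glue.arcs = insert s(x, y) R :=
      (Finset.insert_erase ((mk_mem_arcs _ _ _).2 hgx)).symm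
    have harcs : σ.arcs = insert s(none, some (some x)) (insert s(some none, some (some y))
        (R.image (Sym2.map (fun x => some (some x))))) := by
      ext z
      induction z using Sym2.ind with | _ u v =>
      rw [mk_mem_arcs, Finset.mem_insert, Finset.mem_insert, Finset.mem_image]
      constructor
      · rintro rfl
        rcases u with _ | _ | u
        · left; rw [h]
        · right; left; rw [hy]
        · by_cases hux : u = x
          · subst hux; left; rw [h1, Sym2.eq_swap]
          by_cases huy : u = y
          · subst huy; right; left; rw [h2, Sym2.eq_swap]
          right; right
          have := (hg u hux huy _).1 rfl
          rw [this]
          exact ⟨s(u, σ.glue.arc u), (hmemR _ _).2 ⟨hux, huy, this⟩, by simp⟩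
      · rintro (h' | h' | ⟨w, hw, h'⟩)
        · rw [Sym2.eq_iff] at h'
          rcases h' with ⟨rfl, rfl⟩ | ⟨rfl, rfl⟩
          · exact h
          · exact h1
        · rw [Sym2.eq_iff] at h'
          rcases h' with ⟨rfl, rfl⟩ | ⟨rfl, rfl⟩
          · exact hy
          · exact h2
        · induction w using Sym2.ind with | _ u' v' =>
          obtain ⟨-, -, hw⟩ := (hmemR _ _).1 hw
          rw [Sym2.map_mk, Sym2.eq_iff] at h'
          rcases h' with ⟨rfl, rfl⟩ | ⟨rfl, rfl⟩
          · exact hw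
          · rw [← hw, σ.arc_arc]
    have hprod : ∀ i, σ.prodWeight W (extLabel l (a i) (b i)) =
        (W s(l x, a i) * W s(b i, l y)) * ∏ z ∈ R, W (z.map l) := by
      intro i
      unfold prodWeight
      rw [harcs, Finset.prod_insert, Finset.prod_insert, Finset.prod_image]
      · simp only [Sym2.map_map, Sym2.map_mk, extLabel]
        rw [Sym2.eq_swap (a := a i), mul_assoc]
        rfl
      · exact fun u _ v _ h => Sym2.map.injective
          (fun p q h => by simpa using h) h
      · rw [Finset.mem_image]
        rintro ⟨w, -, hw⟩
        induction w using Sym2.ind with | _ u v =>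
        simp at hw
      · rw [Finset.mem_insert, Finset.mem_image, Sym2.eq_iff]
        rintro (h' | ⟨w, -, hw⟩)
        · simp at h'
        · induction w using Sym2.ind with | _ u v =>
          simp at hw
    simp_rw [hprod]
    rw [← Finset.sum_mul, hW, hloops, pow_zero, one_mul]
    unfold prodWeight
    rw [hgl, Finset.prod_insert (by simp [hR])]
    simp

theorem prodWeight_glueAll (W : Sym2 L → ℝ) {ι : Type} [Fintype ι] (a b : ι → L) (t : ℝ)
    (hW : ∀ x y : L, ∑ i, W s(x, a i) * W s(b i, y) = W s(x, y))
    (ht : ∑ i, W s(a i, b i) = t) (p : ℕ) (σ : Pairing (X ⊕ (Fin p ⊕ Fin p))) (l : X → L) :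
    ∑ K : Fin p → ι, σ.prodWeight W (Sum.elim l (Sum.elim (a ∘ K) (b ∘ K))) =
      t ^ (glueAll p σ).2 * (glueAll p σ).1.prodWeight W l := by
  induction p with
  | zero =>
    simp only [Finset.univ_unique, Finset.sum_singleton, glueAll, pow_zero, one_mul]
    rw [prodWeight_map]
    congr 1
    funext x
    rcases x with x | x | x
    · simp
    · exact x.elim0
    · exact x.elim0
  | succ p ih =>
    rw [← (Fin.consEquiv (fun _ => ι)).sum_comp, Fintype.sum_prod_type, Finset.sum_comm]
    have key : ∀ (K : Fin p → ι) (i : ι),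
        σ.prodWeight W (Sum.elim l (Sum.elim (a ∘ (Fin.consEquiv fun _ => ι) (i, K))
          (b ∘ (Fin.consEquiv fun _ => ι) (i, K)))) =
        (σ.map (peel X p)).prodWeight W
          (extLabel (Sum.elim l (Sum.elim (a ∘ K) (b ∘ K))) (a i) (b i)) := by
      intro K i
      rw [prodWeight_map]
      congr 1
      funext x
      rcases x with x | k | k
      · rfl
      · induction k using Fin.cases <;> rfl
      · induction k using Fin.cases <;> rfl
    simp_rw [key, prodWeight_glue _ W _ a b t hW ht]
    rw [← Finset.mul_sum, ih]
    simp only [glueAll]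
    rw [pow_add]
    ring

end Pairing

namespace DualityStructure

open Pairing

variable {V : Type u} [AddCommGroup V] [Module ℝ V] (𝔡 : DualityStructure V)
  [FiniteDimensional ℝ V]

/-- Labels of the incoming and outgoing points by basis indices. -/
def label {m n : ℕ} (I : Fin m → Idx V) (J : Fin n → Idx V) : Fin m ⊕ Fin n → Bool × Idx V :=
  Sum.elim (fun x => (false, I x)) (fun y => (true, J y))

/-- The matrix of `Y(φ)`. -/
def yMat {m n : ℕ} (φ : BrHom m n) : Matrix (Fin n → Idx V) (Fin m → Idx V) ℝ :=
  Matrix.of fun J I => 𝔡.trace ^ φ.loops * φ.pairing.prodWeight 𝔡.weight (label I J)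

theorem weight_glue (x y : Bool × Idx V) :
    ∑ i, 𝔡.weight s(x, (true, i)) * 𝔡.weight s((false, i), y) = 𝔡.weight s(x, y) := by
  rcases x with ⟨_ | _, a⟩ <;> rcases y with ⟨_ | _, b⟩ <;> simp [weight]
  have := 𝔡.eMat_iMat b a
  rw [eq_comm] at this
  simp_rw [𝔡.iMat_symm a, 𝔡.eMat_symm _ b, mul_comm (𝔡.iMat _ a)]
  rw [← this]
  simp [eq_comm]

theorem weight_loop : ∑ i : Idx V, 𝔡.weight s((true, i), (false, i)) = 𝔡.trace := by
  simp [weight, trace_eq]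

theorem yMat_comp {m p n : ℕ} (ψ : BrHom p n) (φ : BrHom m p) :
    𝔡.yMat (ψ.comp φ) = 𝔡.yMat ψ * 𝔡.yMat φ := by
  ext J I
  rw [Matrix.mul_apply]
  simp only [yMat, Matrix.of_apply, BrHom.comp]
  rw [pow_add, pow_add, mul_assoc, ← prodWeight_glueAll 𝔡.weight (fun i => (true, i))
    (fun i => (false, i)) 𝔡.trace 𝔡.weight_glue 𝔡.weight_loop, Finset.mul_sum]
  refine Finset.sum_congr rfl fun K _ => ?_
  rw [prodWeight_map, prodWeight_sum]
  have h1 : (Sum.elim (label I J) (Sum.elim ((fun i => (true, i)) ∘ K)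
      ((fun i => (false, i)) ∘ K)) ∘ ((Equiv.sumCongr (Equiv.refl _) (Equiv.sumComm _ _)).trans
      (Equiv.sumSumSumComm (Fin m) (Fin p) (Fin n) (Fin p)))) ∘ Sum.inl = label I K := by
    funext x; rcases x with x | x <;> rfl
  have h2 : (Sum.elim (label I J) (Sum.elim ((fun i => (true, i)) ∘ K)
      ((fun i => (false, i)) ∘ K)) ∘ ((Equiv.sumCongr (Equiv.refl _) (Equiv.sumComm _ _)).trans
      (Equiv.sumSumSumComm (Fin m) (Fin p) (Fin n) (Fin p)))) ∘ Sum.inr = label K J := by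
    funext x; rcases x with x | x <;> rfl
  rw [h1, h2]
  ring

theorem yMat_id (m : ℕ) : 𝔡.yMat (BrHom.id m) = 1 := by
  classical
  ext J I
  simp only [yMat, Matrix.of_apply, BrHom.id, pow_zero, one_mul]
  have harcs : (⟨Sum.swap, by simp, by rintro (x | x) <;> simp⟩ :
      Pairing (Fin m ⊕ Fin m)).arcs = Finset.univ.image fun k => s(Sum.inl k, Sum.inr k) := by
    ext z
    induction z using Sym2.ind with | _ u v =>
    rw [mk_mem_arcs]
    rcases u with u | u <;> rcases v with v | v <;> simp [eq_comm]
  unfold prodWeight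
  rw [harcs, Finset.prod_image (fun a _ b _ h => by simpa using h)]
  simp only [Sym2.map_mk, label, Sum.elim_inl, Sum.elim_inr, weight, Sym2.lift_mk]
  rw [Finset.prod_ite_zero]
  simp [Matrix.one_apply, funext_iff, eq_comm]

theorem yMat_tensor {m n m' n' : ℕ} (φ : BrHom m n) (φ' : BrHom m' n') (I : Fin m → Idx V)
    (J : Fin n → Idx V) (I' : Fin m' → Idx V) (J' : Fin n' → Idx V) :
    𝔡.yMat (φ.tensor φ') (Fin.append J J') (Fin.append I I') =
      𝔡.yMat φ J I * 𝔡.yMat φ' J' I' := by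
  simp only [yMat, Matrix.of_apply, BrHom.tensor]
  rw [prodWeight_map, prodWeight_sum, pow_add]
  have h1 : (label (Fin.append I I') (Fin.append J J') ∘
      ((Equiv.sumSumSumComm (Fin m) (Fin n) (Fin m') (Fin n')).trans
      (Equiv.sumCongr finSumFinEquiv finSumFinEquiv))) ∘ Sum.inl = label I J := by
    funext x; rcases x with x | x <;> simp [label]
  have h2 : (label (Fin.append I I') (Fin.append J J') ∘
      ((Equiv.sumSumSumComm (Fin m) (Fin n) (Fin m') (Fin n')).trans
      (Equiv.sumCongr finSumFinEquiv finSumFinEquiv))) ∘ Sum.inr = label I' J' := by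
    funext x; rcases x with x | x <;> simp [label]
  rw [h1, h2]
  ring

end DualityStructure

/-- The tensor product `f ⊗ g : V^{⊗(m + m')} → V^{⊗(n + n')}` of linear maps
`f : V^{⊗m} → V^{⊗n}` and `g : V^{⊗m'} → V^{⊗n'}`. -/
def tensorMap {V : Type u} [AddCommGroup V] [Module ℝ V] {m n m' n' : ℕ}
    (f : (⨂[ℝ]^m V) →ₗ[ℝ] (⨂[ℝ]^n V)) (g : (⨂[ℝ]^m' V) →ₗ[ℝ] (⨂[ℝ]^n' V)) :
    (⨂[ℝ]^(m + m') V) →ₗ[ℝ] (⨂[ℝ]^(n + n') V) :=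
  TensorPower.mulEquiv.toLinearMap ∘ₗ TensorProduct.map f g ∘ₗ
    TensorPower.mulEquiv.symm.toLinearMap

namespace DualityStructure

open Pairing

variable {V : Type u} [AddCommGroup V] [Module ℝ V] (𝔡 : DualityStructure V)
  [FiniteDimensional ℝ V]

variable (V) in
/-- The standard basis of `V^{⊗n}`. -/
def tensorBasis (n : ℕ) : Module.Basis (Fin n → Idx V) ℝ (⨂[ℝ]^n V) :=
  Basis.piTensorProduct fun _ => basis V

/-- The linear representation `Y` of the Brauer category on morphisms,
`Y(φ) : V^{⊗m} → V^{⊗n}`. It sends arcs between two outgoing points to `i`, arcs between two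
incoming points to `e`, arcs between an incoming and an outgoing point to the identity and loops
to the trace of `(i, e)`. -/
def Y {m n : ℕ} (φ : BrHom m n) : (⨂[ℝ]^m V) →ₗ[ℝ] (⨂[ℝ]^n V) :=
  Matrix.toLin (tensorBasis V m) (tensorBasis V n) (𝔡.yMat φ)

theorem Y_id (m : ℕ) : 𝔡.Y (BrHom.id m) = LinearMap.id := by
  rw [Y, yMat_id, Matrix.toLin_one]

theorem Y_comp {m p n : ℕ} (ψ : BrHom p n) (φ : BrHom m p) :
    𝔡.Y (ψ.comp φ) = 𝔡.Y ψ ∘ₗ 𝔡.Y φ := by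
  rw [Y, yMat_comp, Matrix.toLin_mul _ (tensorBasis V p)]
  rfl

theorem mulEquiv_basis {m n : ℕ} (I : Fin m → Idx V) (J : Fin n → Idx V) :
    TensorPower.mulEquiv (tensorBasis V m I ⊗ₜ tensorBasis V n J) =
      tensorBasis V (m + n) (Fin.append I J) := by
  simp only [tensorBasis, Basis.piTensorProduct_apply]
  rw [← TensorPower.gMul_def, TensorPower.tprod_mul_tprod]
  congr 1
  funext x
  refine Fin.addCases (fun i => ?_) (fun i => ?_) x <;> simp

theorem Y_tensor {m n m' n' : ℕ} (φ : BrHom m n) (φ' : BrHom m' n') :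
    𝔡.Y (φ.tensor φ') = tensorMap (𝔡.Y φ) (𝔡.Y φ') := by
  refine (tensorBasis V (m + m')).ext fun K => ?_
  obtain ⟨I, I', rfl⟩ : ∃ I I', Fin.append I I' = K :=
    ⟨_, _, Fin.append_castAdd_natAdd⟩
  have h : TensorPower.mulEquiv.symm (tensorBasis V (m + m') (Fin.append I I')) =
      tensorBasis V m I ⊗ₜ[ℝ] tensorBasis V m' I' := by
    rw [LinearEquiv.symm_apply_eq, mulEquiv_basis]
  simp only [tensorMap, LinearMap.comp_apply, LinearEquiv.coe_coe, h, TensorProduct.map_tmul]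
  simp only [Y, Matrix.toLin_self, TensorProduct.sum_tmul, TensorProduct.tmul_sum, map_sum,
    ← TensorProduct.smul_tmul', TensorProduct.tmul_smul, map_smul, mulEquiv_basis, smul_smul,
    Finset.smul_sum]
  rw [← (Fin.appendEquiv n n').sum_comp, Fintype.sum_prod_type]
  rw [Finset.sum_comm]
  refine Finset.sum_congr rfl fun J' _ => Finset.sum_congr rfl fun J _ => ?_
  rw [show (Fin.appendEquiv n n') (J, J') = Fin.append J J' from rfl, yMat_tensor, mul_comm]

theorem exists_eMat [Nontrivial V] : ∃ a b, 𝔡.eMat a b ≠ 0 := by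
  by_contra! h
  have := 𝔡.eMat_iMat ⟨0, Module.finrank_pos⟩ ⟨0, Module.finrank_pos⟩
  simp [h] at this

theorem exists_iMat [Nontrivial V] : ∃ a b, 𝔡.iMat a b ≠ 0 := by
  by_contra! h
  have := 𝔡.eMat_iMat ⟨0, Module.finrank_pos⟩ ⟨0, Module.finrank_pos⟩
  simp [h] at this

theorem Y_ne_zero [Nontrivial V] {m n : ℕ} (φ : BrHom m n) : 𝔡.Y φ ≠ 0 := by
  classical
  obtain ⟨a, b, hab⟩ := 𝔡.exists_eMat
  obtain ⟨a', b', hab'⟩ := 𝔡.exists_iMat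
  set σ := φ.pairing
  let idx : Fin m ⊕ Fin n → Idx V := fun x => match x, σ.arc x with
    | .inl u, .inl v => if u < v then a else b
    | .inr u, .inr v => if u < v then a' else b'
    | _, _ => a
  have hne : 𝔡.yMat φ (idx ∘ Sum.inr) (idx ∘ Sum.inl) ≠ 0 := by
    simp only [yMat, Matrix.of_apply]
    refine mul_ne_zero (pow_ne_zero _ ?_) (Finset.prod_ne_zero_iff.2 fun z hz => ?_)
    · rw [trace_eq]
      exact_mod_cast Module.finrank_pos.ne'
    · induction z using Sym2.ind with | _ x y =>
      rw [mk_mem_arcs] at hz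
      have hz' : σ.arc y = x := by rw [← hz, σ.arc_arc]
      have hxy : x ≠ y := by rw [← hz]; exact (σ.arc_ne x).symm
      rcases x with x | x <;> rcases y with y | y
      · simp only [Sym2.map_mk, label, Sum.elim_inl, Function.comp, weight, Sym2.lift_mk, idx]
        change σ.arc _ = _ at hz
        rw [hz, hz']
        have : x ≠ y := fun h => hxy (by rw [h])
        rcases lt_or_gt_of_ne this with h | h
        · simpa [h, h.not_gt] using hab
        · rw [𝔡.eMat_symm]; simpa [h, h.not_gt] using hab
      · simp only [Sym2.map_mk, label, Sum.elim_inl, Sum.elim_inr, Function.comp, weight,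
          Sym2.lift_mk, idx]
        change σ.arc _ = _ at hz
        rw [hz, hz']
        simp
      · simp only [Sym2.map_mk, label, Sum.elim_inl, Sum.elim_inr, Function.comp, weight,
          Sym2.lift_mk, idx]
        change σ.arc _ = _ at hz
        rw [hz, hz']
        simp
      · simp only [Sym2.map_mk, label, Sum.elim_inr, Function.comp, weight, Sym2.lift_mk, idx]
        change σ.arc _ = _ at hz
        rw [hz, hz']
        have : x ≠ y := fun h => hxy (by rw [h])
        rcases lt_or_gt_of_ne this with h | h
        · simpa [h, h.not_gt] using hab'
        · rw [𝔡.iMat_symm]; simpa [h, h.not_gt] using hab'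
  intro h0
  have : 𝔡.yMat φ = 0 :=
    (Matrix.toLin (tensorBasis V m) (tensorBasis V n)).injective (by rw [map_zero]; exact h0)
  exact hne (by rw [this]; rfl)

/-- `Y` is faithful on loops. -/
def FaithfulOnLoops : Prop :=
  ∀ {m n : ℕ} (φ ψ : BrHom m n), 𝔡.Y φ = 𝔡.Y ψ → φ.loops = ψ.loops

end DualityStructure

/-! ### Profinite idempotent completion -/

/-- A `c`-scalable and `c`-profinite subset of a real vector space, `c ≠ 0, 1, -1`. -/
structure ProfiniteSet (E : Type u) [AddCommGroup E] [Module ℝ E] where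
  carrier : Set E
  c : ℝ
  c_ne_zero : c ≠ 0
  c_ne_one : c ≠ 1
  c_ne_neg_one : c ≠ -1
  zero_notMem : (0 : E) ∉ carrier
  smul_mem : ∀ h ∈ carrier, c • h ∈ carrier
  exists_gen : ∃ H₀ : Set E, H₀ ⊆ carrier ∧ H₀.Finite ∧
    ∀ h ∈ carrier, ∃ n : ℕ, ∃ h₀ ∈ H₀, h = c ^ n • h₀

namespace ProfiniteSet

variable {E : Type u} [AddCommGroup E] [Module ℝ E] (H : ProfiniteSet E)

/-- The action of the generator `τ` of `ℕ` on `H`. -/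
def shift (h : H.carrier) : H.carrier := ⟨H.c • h.1, H.smul_mem _ h.2⟩

theorem shift_iterate (n : ℕ) (h : H.carrier) :
    ((H.shift^[n] h : H.carrier) : E) = H.c ^ n • h.1 := by
  induction n with
  | zero => simp
  | succ n ih =>
    rw [Function.iterate_succ_apply']
    change H.c • ((H.shift^[n] h : H.carrier) : E) = _
    rw [ih, smul_smul, ← pow_succ']

/-- The minimal shell: the irreducible elements of `H`. -/
def shell : Set H.carrier := {h | ∀ n : ℕ, 0 < n → ∀ h₀, h ≠ H.shift^[n] h₀}

theorem pow_inj {m n : ℕ} {x : E} (hx : x ≠ 0) (h : H.c ^ m • x = H.c ^ n • x) : m = n := by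
  have h1 : H.c ^ m = H.c ^ n := smul_left_injective ℝ hx h
  have h2 : |H.c| ^ m = |H.c| ^ n := by rw [← abs_pow, h1, abs_pow]
  refine pow_right_injective₀ (abs_pos.2 H.c_ne_zero) (fun h => ?_) h2
  rcases (abs_eq zero_le_one).1 h with h | h
  · exact H.c_ne_one h
  · exact H.c_ne_neg_one h

theorem ne_zero (h : H.carrier) : (h : E) ≠ 0 := fun h0 => H.zero_notMem (h0 ▸ h.2)

theorem exists_shell (h : H.carrier) : ∃ n : ℕ, ∃ s ∈ H.shell, h = H.shift^[n] s := by
  by_contra! hcon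
  have hall : ∀ n : ℕ, ∃ x : H.carrier, ∃ k, n ≤ k ∧ h = H.shift^[k] x := by
    intro n
    induction n with
    | zero => exact ⟨h, 0, le_rfl, rfl⟩
    | succ n ih =>
      obtain ⟨x, k, hk, hx⟩ := ih
      have hns : x ∉ H.shell := fun hs => hcon k x hs hx
      simp only [shell, Set.mem_ofPred_eq, not_forall, not_not] at hns
      obtain ⟨j, hj, y, rfl⟩ := hns
      exact ⟨y, k + j, by omega, by rw [hx, Function.iterate_add_apply]⟩
  obtain ⟨H₀, -, hfin, hgen⟩ := H.exists_gen
  have hall' : ∀ n : ℕ, ∃ g ∈ H₀, ∃ k, n ≤ k ∧ (h : E) = H.c ^ k • g := by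
    intro n
    obtain ⟨x, k, hk, hx⟩ := hall n
    obtain ⟨j, g, hg, hj⟩ := hgen x.1 x.2
    refine ⟨g, hg, k + j, by omega, ?_⟩
    rw [hx, shift_iterate, hj, smul_smul, ← pow_add]
  have hk : ∀ g ∈ H₀, ∃ B : ℕ, ∀ k, (h : E) = H.c ^ k • g → k ≤ B := by
    intro g _
    by_cases hex : ∃ k, (h : E) = H.c ^ k • g
    · obtain ⟨k, hk⟩ := hex
      refine ⟨k, fun k' hk' => (H.pow_inj (x := g) ?_ (hk'.symm.trans hk)).le⟩
      rintro rfl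
      exact H.ne_zero h (by simp [hk])
    · exact ⟨0, fun k hk => absurd ⟨k, hk⟩ hex⟩
  choose! B hB using hk
  obtain ⟨N, hN⟩ := (hfin.image B).bddAbove
  obtain ⟨g, hg, k, hk, hkg⟩ := hall' (N + 1)
  have h1 := hB g hg k hkg
  have h2 := hN ⟨g, hg, rfl⟩
  omega

theorem shell_unique {m n : ℕ} {s t : H.carrier} (hs : s ∈ H.shell) (ht : t ∈ H.shell)
    (h : H.shift^[m] s = H.shift^[n] t) : m = n ∧ s = t := by
  have hinj : ∀ k : ℕ, Function.Injective (H.shift^[k]) := by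
    intro k x y hxy
    have := congrArg Subtype.val hxy
    rw [shift_iterate, shift_iterate] at this
    exact Subtype.ext (smul_right_injective E (pow_ne_zero k H.c_ne_zero) this)
  rcases lt_trichotomy m n with hmn | rfl | hmn
  · obtain ⟨k, rfl⟩ := Nat.exists_eq_add_of_lt hmn
    rw [add_assoc, Function.iterate_add_apply] at h
    exact absurd (hinj _ h) (hs _ (by omega) _)
  · exact ⟨rfl, hinj _ h⟩
  · obtain ⟨k, rfl⟩ := Nat.exists_eq_add_of_lt hmn
    rw [add_assoc, Function.iterate_add_apply] at h
    exact absurd (hinj _ h).symm (ht _ (by omega) _)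

instance finite_shell : Finite H.shell := by
  obtain ⟨H₀, hsub, hfin, hgen⟩ := H.exists_gen
  have : Finite H₀ := hfin
  refine Finite.of_injective (β := H₀) (fun s => ⟨s.1.1, ?_⟩) ?_
  · obtain ⟨n, g, hg, h⟩ := hgen s.1.1 s.1.2
    rcases Nat.eq_zero_or_pos n with rfl | hn
    · rw [h]; simpa using hg
    · refine absurd (Subtype.ext ?_) (s.2 n hn ⟨g, hsub hg⟩)
      rw [shift_iterate, h]
  · intro s t h
    exact Subtype.ext (Subtype.ext (by simpa using congrArg Subtype.val h))

instance : Fintype H.shell := Fintype.ofFinite _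

/-- Every element of `H` is uniquely of the form `cⁿ s` with `s` in the minimal shell. -/
def shellParam : ℕ × H.shell ≃ H.carrier :=
  Equiv.ofBijective (fun p => H.shift^[p.1] p.2.1)
    ⟨fun p q h => by
      obtain ⟨h1, h2⟩ := H.shell_unique p.2.2 q.2.2 h
      exact Prod.ext h1 (Subtype.ext h2),
    fun h => by
      obtain ⟨n, s, hs, rfl⟩ := H.exists_shell h
      exact ⟨(n, ⟨s, hs⟩), rfl⟩⟩

end ProfiniteSet

/-! ### Boolean power series -/

/-- The Boolean semiring `𝔹`, with `1 + 1 = 1`. -/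
def BoolSR : Type := Bool

instance : Zero BoolSR := ⟨false⟩
instance : One BoolSR := ⟨true⟩
instance : Add BoolSR := ⟨or⟩
instance : Mul BoolSR := ⟨and⟩

instance : CommSemiring BoolSR where
  add_assoc := Bool.or_assoc
  zero_add := Bool.false_or
  add_zero := Bool.or_false
  add_comm := Bool.or_comm
  mul_assoc := Bool.and_assoc
  one_mul := Bool.true_and
  mul_one := Bool.and_true
  mul_comm := Bool.and_comm
  left_distrib := Bool.and_or_distrib_left
  right_distrib := Bool.and_or_distrib_right
  zero_mul := Bool.false_and
  mul_zero := Bool.and_false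
  nsmul := nsmulRec
  npow := npowRec

namespace BoolSR

/-- The truth value of an element of `𝔹`. -/
def Holds (b : BoolSR) : Prop := b = 1

theorem holds_zero : ¬ Holds 0 := by unfold Holds; exact Bool.false_ne_true
theorem holds_one : Holds 1 := rfl
theorem holds_add (a b : BoolSR) : Holds (a + b) ↔ Holds a ∨ Holds b :=
  Bool.or_eq_true_iff (x := a) (y := b)
theorem holds_mul (a b : BoolSR) : Holds (a * b) ↔ Holds a ∧ Holds b :=
  Bool.and_eq_true_iff (x := a) (y := b)
theorem holds_sum {ι : Type*} (s : Finset ι) (f : ι → BoolSR) :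
    Holds (∑ i ∈ s, f i) ↔ ∃ i ∈ s, Holds (f i) := by
  classical
  induction s using Finset.induction_on with
  | empty => simp [holds_zero]
  | insert a s ha ih => rw [Finset.sum_insert ha, holds_add, ih]; simp

theorem ext {a b : BoolSR} (h : Holds a ↔ Holds b) : a = b := Bool.eq_iff_iff.2 h

open Classical in
/-- The element of `𝔹` with a given truth value. -/
def ofProp (p : Prop) : BoolSR := if p then 1 else 0

theorem holds_ofProp (p : Prop) : Holds (ofProp p) ↔ p := by
  unfold ofProp
  split_ifs with h
  · exact iff_of_true holds_one h
  · exact iff_of_false holds_zero h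

/-- The set of exponents of a Boolean power series. -/
def supp (b : PowerSeries BoolSR) : Set ℕ := {k | Holds (PowerSeries.coeff k b)}

theorem supp_injective : Function.Injective supp := fun a b h => by
  ext k
  exact BoolSR.ext (Set.ext_iff.1 h k)

theorem mem_supp_mul (a b : PowerSeries BoolSR) (k : ℕ) :
    k ∈ supp (a * b) ↔ ∃ i ∈ supp a, ∃ j ∈ supp b, i + j = k := by
  unfold supp
  rw [Set.mem_ofPred_eq, PowerSeries.coeff_mul, holds_sum]
  simp only [Finset.HasAntidiagonal.mem_antidiagonal, holds_mul, Prod.exists, Set.mem_ofPred_eq]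
  constructor
  · rintro ⟨i, j, h, hi, hj⟩; exact ⟨i, hi, j, hj, h⟩
  · rintro ⟨i, hi, j, hj, h⟩; exact ⟨i, j, h, hi, hj⟩

theorem supp_add (a b : PowerSeries BoolSR) : supp (a + b) = supp a ∪ supp b := by
  ext k; simp [supp, holds_add]

theorem supp_zero : supp 0 = ∅ := by
  ext k; simp [supp, holds_zero]

theorem mem_supp_X_pow (n k : ℕ) : k ∈ supp (PowerSeries.X ^ n) ↔ k = n := by
  simp only [supp, Set.mem_ofPred_eq, PowerSeries.coeff_X_pow]
  split_ifs with h
  · exact iff_of_true holds_one h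
  · exact iff_of_false holds_zero h

/-- The power series with a given set of exponents. -/
def ofSet (A : Set ℕ) : PowerSeries BoolSR := PowerSeries.mk fun k => ofProp (k ∈ A)

theorem supp_ofSet (A : Set ℕ) : supp (ofSet A) = A := by
  ext k; simp [supp, ofSet, holds_ofProp]

theorem ofSet_supp (b : PowerSeries BoolSR) : ofSet (supp b) = b :=
  supp_injective (supp_ofSet _)

theorem supp_sum {ι : Type*} (s : Finset ι) (f : ι → PowerSeries BoolSR) :
    supp (∑ i ∈ s, f i) = ⋃ i ∈ s, supp (f i) := by
  ext k
  simp [supp, holds_sum]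

/-- The summation law of `𝔹[[q]]` (coefficientwise). -/
def isumPS {I : Type*} (f : I → PowerSeries BoolSR) : PowerSeries BoolSR :=
  ofSet (⋃ i, supp (f i))

end BoolSR

open BoolSR

/-! ### The semimodule `Q(H)` -/

namespace ProfiniteSet

variable {E : Type u} [AddCommGroup E] [Module ℝ E] (H : ProfiniteSet E)

/-- The free commutative monoid `FM(H)` as an `ℕ[τ]`-semimodule. -/
abbrev FM : Type u := Module.AEval' (Finsupp.lmapDomain ℕ ℕ H.shift)

/-- `Q(H) = FM(H) ⊗_{ℕ[τ]} 𝔹[[q]]`; here `τ` acts on `𝔹[[q]]` as multiplication by `q`. -/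
def QH : Type u := H.FM ⊗[ℕ[X]] PowerSeries BoolSR

instance : AddCommMonoid H.QH :=
  inferInstanceAs (AddCommMonoid (H.FM ⊗[ℕ[X]] PowerSeries BoolSR))

/-- The element `h ∈ H` of `FM(H)`. -/
def single (h : H.carrier) : H.FM := Module.AEval'.of _ (Finsupp.single h 1)

variable {H} in
/-- The pure tensor `h ⊗ b`. -/
def pure (h : H.carrier) (b : PowerSeries BoolSR) : H.QH := H.single h ⊗ₜ[ℕ[X]] b

theorem polyX_smul (b : PowerSeries BoolSR) :
    (Polynomial.X : ℕ[X]) • b = PowerSeries.X * b := by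
  rw [Algebra.smul_def, PowerSeries.algebraMap_apply']
  simp

theorem polyX_pow_smul (n : ℕ) (b : PowerSeries BoolSR) :
    (Polynomial.X ^ n : ℕ[X]) • b = PowerSeries.X ^ n * b := by
  rw [Algebra.smul_def, PowerSeries.algebraMap_apply']
  simp

theorem X_smul_single (h : H.carrier) :
    (Polynomial.X : ℕ[X]) • H.single h = H.single (H.shift h) := by
  unfold single
  rw [Module.AEval'.X_smul_of]
  simp

theorem X_pow_smul_single (n : ℕ) (h : H.carrier) :
    (Polynomial.X ^ n : ℕ[X]) • H.single h = H.single (H.shift^[n] h) := by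
  induction n with
  | zero => simp
  | succ n ih => rw [pow_succ', mul_smul, ih, X_smul_single, Function.iterate_succ_apply']

theorem pure_shift (n : ℕ) (h : H.carrier) (b : PowerSeries BoolSR) :
    pure (H.shift^[n] h) b = pure h (PowerSeries.X ^ n * b) := by
  unfold pure
  rw [← X_pow_smul_single, TensorProduct.smul_tmul, polyX_pow_smul]

theorem pure_add (h : H.carrier) (b b' : PowerSeries BoolSR) :
    pure h (b + b') = pure h b + pure h b' := TensorProduct.tmul_add _ _ _

theorem pure_zero (h : H.carrier) : pure h 0 = 0 := TensorProduct.tmul_zero _ _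

open Classical in
/-- The contribution of `h = τᵏ t`, `t` in the minimal shell, to the coordinate at `s`. -/
def coordGen (s : H.shell) (h : H.carrier) : PowerSeries BoolSR :=
  if (H.shellParam.symm h).2 = s then PowerSeries.X ^ (H.shellParam.symm h).1 else 0

open Classical in
theorem coordGen_eq (s : H.shell) (k : ℕ) (t : H.shell) :
    H.coordGen s (H.shift^[k] t.1) = if t = s then PowerSeries.X ^ k else 0 := by
  have h : H.shellParam.symm (H.shift^[k] t.1) = (k, t) :=
    H.shellParam.symm_apply_apply (k, t)
  unfold coordGen
  rw [h]

theorem coordGen_shift (s : H.shell) (h : H.carrier) :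
    H.coordGen s (H.shift h) = PowerSeries.X * H.coordGen s h := by
  obtain ⟨⟨k, t⟩, rfl⟩ := H.shellParam.surjective h
  change H.coordGen s (H.shift (H.shift^[k] t.1)) = _ * H.coordGen s (H.shift^[k] t.1)
  rw [← Function.iterate_succ_apply' H.shift k t.1, coordGen_eq, coordGen_eq]
  split_ifs
  · rw [pow_succ']
  · rw [mul_zero]

/-- The shell coordinate functional on `FM(H)`, with values in `𝔹[[q]]`. -/
def coordFM (s : H.shell) : H.FM →ₗ[ℕ[X]] PowerSeries BoolSR :=
  LinearMap.ofAEval (N := PowerSeries BoolSR) (Finsupp.lmapDomain ℕ ℕ H.shift)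
    (Finsupp.linearCombination ℕ (H.coordGen s)) (by
    intro m
    rw [polyX_smul]
    induction m using Finsupp.induction_linear with
    | zero => simp
    | add f g hf hg => rw [smul_add, map_add, map_add, hf, hg, mul_add]
    | single h n =>
      simp [coordGen_shift]
      ring)

theorem coordFM_single (s : H.shell) (h : H.carrier) :
    H.coordFM s (H.single h) = H.coordGen s h := by
  change Finsupp.linearCombination ℕ (H.coordGen s) (Finsupp.single h 1) = _
  simp

/-- The shell coordinate `b_s` of an element of `Q(H)`. -/
def coord (s : H.shell) : H.QH →+ PowerSeries BoolSR :=
  (TensorProduct.lift ((LinearMap.mul ℕ[X] (PowerSeries BoolSR)) ∘ₗ H.coordFM s)).toAddMonoidHom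

theorem coord_pure (s : H.shell) (h : H.carrier) (b : PowerSeries BoolSR) :
    H.coord s (pure h b) = H.coordGen s h * b := by
  rw [← coordFM_single]
  rfl

theorem QH_induction {p : H.QH → Prop} (zero : p 0) (add : ∀ f g, p f → p g → p (f + g))
    (pure_mem : ∀ (s : H.shell) b, p (pure s.1 b)) (f : H.QH) : p f := by
  refine TensorProduct.induction_on (motive := p) f zero (fun a b => ?_) add
  suffices h : ∀ a' : H.carrier →₀ ℕ, p (Module.AEval'.of _ a' ⊗ₜ[ℕ[X]] b) from h a
  intro a'
  induction a' using Finsupp.induction_linear with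
  | zero => rw [map_zero, TensorProduct.zero_tmul]; exact zero
  | add f g hf hg => rw [map_add, TensorProduct.add_tmul]; exact add _ _ hf hg
  | single h n =>
    obtain ⟨⟨k, t⟩, rfl⟩ := H.shellParam.surjective h
    induction n with
    | zero => rw [Finsupp.single_zero, map_zero, TensorProduct.zero_tmul]; exact zero
    | succ n ih =>
      rw [Finsupp.single_add, map_add, TensorProduct.add_tmul]
      refine add _ _ ih ?_
      have := H.pure_shift k t.1 b
      unfold pure single at this
      change p (Module.AEval'.of _ (Finsupp.single (H.shift^[k] t.1) 1) ⊗ₜ[ℕ[X]] b)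
      rw [this]
      exact pure_mem t _

/-- The normal form: every element of `Q(H)` is uniquely `∑_s s ⊗ b_s`, where `s` ranges over the
minimal shell. -/
def shellEquiv : (H.shell → PowerSeries BoolSR) ≃+ H.QH where
  toFun b := ∑ s, pure s.1 (b s)
  invFun f s := H.coord s f
  left_inv b := by
    classical
    funext s
    change H.coord s (∑ t, pure t.1 (b t)) = b s
    rw [map_sum]
    have : ∀ t : H.shell, H.coord s (pure t.1 (b t)) = if t = s then b t else 0 := by
      intro t
      have h := H.coordGen_eq s 0 t
      simp only [Function.iterate_zero, id, pow_zero] at h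
      rw [coord_pure, h]
      split_ifs <;> simp
    simp [this]
  right_inv f := by
    classical
    change ∑ s, pure s.1 (H.coord s f) = f
    induction f using H.QH_induction with
    | zero => simp [pure_zero]
    | add f g hf hg => simp only [map_add, pure_add, Finset.sum_add_distrib, hf, hg]
    | pure_mem t b =>
      have : ∀ s : H.shell, pure s.1 (H.coord s (pure t.1 b)) = if t = s then pure t.1 b else 0 := by
        intro s
        have h := H.coordGen_eq s 0 t
        simp only [Function.iterate_zero, id, pow_zero] at h
        rw [coord_pure, h]
        split_ifs with h'
        · rw [one_mul, h']
        · rw [zero_mul, pure_zero]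
      simp [this]
  map_add' b b' := by simp [pure_add, Finset.sum_add_distrib]

theorem shellEquiv_apply (b : H.shell → PowerSeries BoolSR) :
    H.shellEquiv b = ∑ s, pure s.1 (b s) := rfl

/-- The summation law of `Q(H)`: `∑_i ∑_s s ⊗ b_{s,i} = ∑_s s ⊗ (∑_i b_{s,i})`. -/
def isumQH {I : Type u} (f : I → H.QH) : H.QH :=
  H.shellEquiv fun s => isumPS fun i => H.shellEquiv.symm (f i) s

/-- The set of all `τᵏ s` occurring in an element `∑_s s ⊗ b_s`. -/
def suppQH (f : H.QH) : Set H.carrier :=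
  {h | (H.shellParam.symm h).1 ∈ supp (H.shellEquiv.symm f (H.shellParam.symm h).2)}

theorem mem_suppQH (b : H.shell → PowerSeries BoolSR) (h : H.carrier) :
    h ∈ H.suppQH (H.shellEquiv b) ↔ ∃ s : H.shell, ∃ k ∈ supp (b s), H.shift^[k] s.1 = h := by
  unfold suppQH
  rw [Set.mem_ofPred_eq, AddEquiv.symm_apply_apply]
  constructor
  · intro hh
    exact ⟨_, _, hh, H.shellParam.apply_symm_apply h⟩
  · rintro ⟨s, k, hk, rfl⟩
    rwa [show H.shellParam.symm (H.shift^[k] s.1) = (k, s) from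
      H.shellParam.symm_apply_apply (k, s)]

theorem suppQH_injective : Function.Injective H.suppQH := by
  intro f g h
  apply H.shellEquiv.symm.injective
  funext s
  apply supp_injective
  ext k
  have := Set.ext_iff.1 h (H.shellParam (k, s))
  simpa [suppQH] using this

theorem suppQH_zero : H.suppQH 0 = ∅ := by
  ext h
  simp [suppQH, supp_zero]

theorem suppQH_add (f g : H.QH) : H.suppQH (f + g) = H.suppQH f ∪ H.suppQH g := by
  ext h
  simp [suppQH, supp_add]

theorem suppQH_isum {I : Type u} (f : I → H.QH) : H.suppQH (H.isumQH f) = ⋃ i, H.suppQH (f i) := by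
  ext h
  simp [suppQH, isumQH, isumPS, supp_ofSet]

theorem suppQH_sum {ι : Type*} (s : Finset ι) (f : ι → H.QH) :
    H.suppQH (∑ i ∈ s, f i) = ⋃ i ∈ s, H.suppQH (f i) := by
  classical
  induction s using Finset.induction_on with
  | empty => simp [suppQH_zero]
  | insert a s ha ih => rw [Finset.sum_insert ha, suppQH_add, ih]; simp

theorem mem_suppQH_pure (h h' : H.carrier) (b : PowerSeries BoolSR) :
    h' ∈ H.suppQH (pure h b) ↔ ∃ j ∈ supp b, H.shift^[j] h = h' := by
  classical
  obtain ⟨⟨k, t⟩, rfl⟩ := H.shellParam.surjective h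
  have : pure (H.shellParam (k, t)) b =
      H.shellEquiv (Pi.single t (PowerSeries.X ^ k * b)) := by
    change pure (H.shift^[k] t.1) b = _
    rw [pure_shift, shellEquiv_apply, Finset.sum_eq_single t]
    · simp
    · intro s _ hs
      simp [Pi.single_eq_of_ne hs, pure_zero]
    · simp
  rw [this, mem_suppQH]
  change _ ↔ ∃ j ∈ supp b, H.shift^[j] (H.shift^[k] t.1) = h'
  constructor
  · rintro ⟨s, j, hj, rfl⟩
    by_cases hs : s = t
    · subst hs
      rw [Pi.single_eq_same, mem_supp_mul] at hj
      obtain ⟨i, hi, j', hj', rfl⟩ := hj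
      rw [mem_supp_X_pow] at hi
      subst hi
      exact ⟨j', hj', by rw [← Function.iterate_add_apply, add_comm]⟩
    · rw [Pi.single_eq_of_ne hs, supp_zero] at hj
      exact hj.elim
  · rintro ⟨j, hj, rfl⟩
    refine ⟨t, j + k, ?_, Function.iterate_add_apply _ _ _ _⟩
    rw [Pi.single_eq_same, mem_supp_mul]
    exact ⟨k, (mem_supp_X_pow _ _).2 rfl, j, hj, add_comm _ _⟩

instance : CompleteMonoid H.QH where
  isum := H.isumQH
  isum_empty f := H.suppQH_injective (by rw [suppQH_isum, suppQH_zero, Set.iUnion_of_empty])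
  isum_unique f := H.suppQH_injective (by rw [suppQH_isum]; exact iSup_unique _)
  isum_pair f := H.suppQH_injective (by
    rw [suppQH_isum, suppQH_add]
    ext x
    simp only [Set.mem_iUnion, Set.mem_union, ULift.exists, Bool.exists_bool]
    tauto)
  isum_partition π f := H.suppQH_injective (by
    simp only [suppQH_isum]
    ext x
    simp)

end ProfiniteSet

namespace ProfiniteSet

instance {E : Type u} [AddCommGroup E] [Module ℝ E] (H : ProfiniteSet E) :
    IdemContinuous H.QH where
  add_self f := H.suppQH_injective (by rw [suppQH_add, Set.union_self])
  isum_le_of_finite f c h := H.suppQH_injective (by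
    have h' : ∀ i, H.suppQH (f i) ⊆ H.suppQH c := fun i => by
      have := congrArg H.suppQH (h {i})
      rw [Finset.sum_singleton, suppQH_add] at this
      rw [← this]
      exact Set.subset_union_left
    rw [suppQH_add]
    change H.suppQH (H.isumQH f) ∪ _ = _
    rw [suppQH_isum]
    exact Set.union_eq_self_of_subset_left (Set.iUnion_subset h'))

variable {E₁ E₂ E₃ : Type u} [AddCommGroup E₁] [Module ℝ E₁] [AddCommGroup E₂] [Module ℝ E₂]
  [AddCommGroup E₃] [Module ℝ E₃] {H₁ : ProfiniteSet E₁} {H₂ : ProfiniteSet E₂}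
  {H₃ : ProfiniteSet E₃}

/-- The product `Q(H₁) × Q(H₂) → Q(H₃)` induced by `μ : H₁ × H₂ → H₃`: in normal forms,
`(∑_y y ⊗ b_y, ∑_{y'} y' ⊗ b'_{y'}) ↦ ∑_{y, y'} μ(y, y') ⊗ (b_y b'_{y'})`. -/
def bilin (μ : H₁.carrier → H₂.carrier → H₃.carrier) (f : H₁.QH) (f' : H₂.QH) : H₃.QH :=
  ∑ y : H₁.shell, ∑ y' : H₂.shell,
    pure (μ y.1 y'.1) (H₁.shellEquiv.symm f y * H₂.shellEquiv.symm f' y')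

theorem mem_suppQH_bilin {μ : H₁.carrier → H₂.carrier → H₃.carrier}
    (hl : ∀ a b, μ (H₁.shift a) b = H₃.shift (μ a b))
    (hr : ∀ a b, μ a (H₂.shift b) = H₃.shift (μ a b))
    (f : H₁.QH) (f' : H₂.QH) (x : H₃.carrier) :
    x ∈ H₃.suppQH (bilin μ f f') ↔ ∃ a ∈ H₁.suppQH f, ∃ b ∈ H₂.suppQH f', μ a b = x := by
  have hl' : ∀ i a b, μ (H₁.shift^[i] a) b = H₃.shift^[i] (μ a b) := by
    intro i a b
    induction i with
    | zero => rfl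
    | succ i ih => rw [Function.iterate_succ_apply', hl, ih, Function.iterate_succ_apply']
  have hr' : ∀ i a b, μ a (H₂.shift^[i] b) = H₃.shift^[i] (μ a b) := by
    intro i a b
    induction i with
    | zero => rfl
    | succ i ih => rw [Function.iterate_succ_apply', hr, ih, Function.iterate_succ_apply']
  unfold bilin
  simp only [suppQH_sum, Finset.mem_univ, Set.iUnion_true, Set.mem_iUnion, mem_suppQH_pure,
    mem_supp_mul]
  obtain ⟨b, rfl⟩ := H₁.shellEquiv.surjective f
  obtain ⟨b', rfl⟩ := H₂.shellEquiv.surjective f'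
  simp only [mem_suppQH, AddEquiv.symm_apply_apply]
  constructor
  · rintro ⟨y, y', _, ⟨i, hi, j, hj, rfl⟩, rfl⟩
    refine ⟨_, ⟨y, i, hi, rfl⟩, _, ⟨y', j, hj, rfl⟩, ?_⟩
    rw [hl', hr', Function.iterate_add_apply]
  · rintro ⟨_, ⟨y, i, hi, rfl⟩, _, ⟨y', j, hj, rfl⟩, rfl⟩
    refine ⟨y, y', _, ⟨i, hi, j, hj, rfl⟩, ?_⟩
    rw [hl', hr', Function.iterate_add_apply]

theorem suppQH_pure_one {E : Type u} [AddCommGroup E] [Module ℝ E] (H : ProfiniteSet E)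
    (h : H.carrier) : H.suppQH (pure h 1) = {h} := by
  ext x
  have h1 := fun k => mem_supp_X_pow 0 k
  rw [pow_zero] at h1
  rw [mem_suppQH_pure]
  simp [h1, eq_comm]

end ProfiniteSet

/-! ### The profinite idempotent completion of the Brauer category -/

section tensorMap

variable {V : Type u} [AddCommGroup V] [Module ℝ V]

open TensorPower GradedMonoid

theorem tensorMap_mul {m n m' n' : ℕ} (f : (⨂[ℝ]^m V) →ₗ[ℝ] (⨂[ℝ]^n V))
    (g : (⨂[ℝ]^m' V) →ₗ[ℝ] (⨂[ℝ]^n' V)) (x : ⨂[ℝ]^m V) (y : ⨂[ℝ]^m' V) :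
    tensorMap f g (TensorPower.mulEquiv (x ⊗ₜ y)) = TensorPower.mulEquiv (f x ⊗ₜ g y) := by
  simp [tensorMap]

theorem tensorPower_induction {m n : ℕ} {p : (⨂[ℝ]^(m + n) V) → Prop}
    (add : ∀ x y, p x → p y → p (x + y))
    (mul : ∀ (x : ⨂[ℝ]^m V) (y : ⨂[ℝ]^n V), p (TensorPower.mulEquiv (x ⊗ₜ y)))
    (x : ⨂[ℝ]^(m + n) V) : p x := by
  obtain ⟨t, rfl⟩ := TensorPower.mulEquiv.surjective x
  induction t using TensorProduct.induction_on with
  | zero => simpa using mul 0 0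
  | tmul x y => exact mul x y
  | add x y hx hy => rw [map_add]; exact add _ _ hx hy

theorem tensorMap_assoc {m n m' n' m'' n'' : ℕ} (f : (⨂[ℝ]^m V) →ₗ[ℝ] (⨂[ℝ]^n V))
    (g : (⨂[ℝ]^m' V) →ₗ[ℝ] (⨂[ℝ]^n' V)) (h : (⨂[ℝ]^m'' V) →ₗ[ℝ] (⨂[ℝ]^n'' V))
    (x : ⨂[ℝ]^(m + m' + m'') V) :
    TensorPower.cast ℝ V (add_assoc n n' n'') (tensorMap (tensorMap f g) h x) =
      tensorMap f (tensorMap g h) (TensorPower.cast ℝ V (add_assoc m m' m'') x) := by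
  induction x using tensorPower_induction with
  | add x y hx hy => simp only [map_add, hx, hy]
  | mul x z =>
    induction x using tensorPower_induction with
    | add x y hx hy => simp only [map_add, TensorProduct.add_tmul, hx, hy]
    | mul x y =>
      have := fun {a b c : ℕ} (u : ⨂[ℝ]^a V) (v : ⨂[ℝ]^b V) (w : ⨂[ℝ]^c V) =>
        TensorPower.mul_assoc u v w
      simp only [gMul_def] at this
      rw [tensorMap_mul, tensorMap_mul, this, this, tensorMap_mul, tensorMap_mul]

theorem tensorMap_id_left {m n : ℕ} (f : (⨂[ℝ]^m V) →ₗ[ℝ] (⨂[ℝ]^n V)) (x : ⨂[ℝ]^(0 + m) V) :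
    TensorPower.cast ℝ V (zero_add n)
      (tensorMap (LinearMap.id : (⨂[ℝ]^0 V) →ₗ[ℝ] (⨂[ℝ]^0 V)) f x) =
      f (TensorPower.cast ℝ V (zero_add m) x) := by
  induction x using tensorPower_induction with
  | add x y hx hy => simp only [map_add, hx, hy]
  | mul x y =>
    obtain ⟨r, rfl⟩ := (TensorPower.algebraMap₀ (R := ℝ) (M := V)).surjective x
    have := fun {a : ℕ} (u : ⨂[ℝ]^a V) => TensorPower.algebraMap₀_mul r u
    simp only [gMul_def] at this
    rw [tensorMap_mul, LinearMap.id_apply, this, this, map_smul]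

theorem tensorMap_id_right {m n : ℕ} (f : (⨂[ℝ]^m V) →ₗ[ℝ] (⨂[ℝ]^n V)) (x : ⨂[ℝ]^(m + 0) V) :
    TensorPower.cast ℝ V (add_zero n)
      (tensorMap f (LinearMap.id : (⨂[ℝ]^0 V) →ₗ[ℝ] (⨂[ℝ]^0 V)) x) =
      f (TensorPower.cast ℝ V (add_zero m) x) := by
  induction x using tensorPower_induction with
  | add x y hx hy => simp only [map_add, hx, hy]
  | mul y x =>
    obtain ⟨r, rfl⟩ := (TensorPower.algebraMap₀ (R := ℝ) (M := V)).surjective x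
    have := fun {a : ℕ} (u : ⨂[ℝ]^a V) => TensorPower.mul_algebraMap₀ r u
    simp only [gMul_def] at this
    rw [tensorMap_mul, LinearMap.id_apply, this, this, map_smul]

theorem tensorMap_smul_left {m n m' n' : ℕ} (c : ℝ) (f : (⨂[ℝ]^m V) →ₗ[ℝ] (⨂[ℝ]^n V))
    (g : (⨂[ℝ]^m' V) →ₗ[ℝ] (⨂[ℝ]^n' V)) : tensorMap (c • f) g = c • tensorMap f g := by
  refine LinearMap.ext fun x => ?_
  simp [tensorMap, TensorProduct.map_smul_left]

theorem tensorMap_smul_right {m n m' n' : ℕ} (c : ℝ) (f : (⨂[ℝ]^m V) →ₗ[ℝ] (⨂[ℝ]^n V))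
    (g : (⨂[ℝ]^m' V) →ₗ[ℝ] (⨂[ℝ]^n' V)) : tensorMap f (c • g) = c • tensorMap f g := by
  refine LinearMap.ext fun x => ?_
  simp [tensorMap, TensorProduct.map_smul_right]

end tensorMap

instance finiteDimensional_of_fact (V : Type u) [AddCommGroup V] [Module ℝ V]
    [h : Fact (2 ≤ Module.finrank ℝ V)] : FiniteDimensional ℝ V :=
  Module.finite_of_finrank_pos (lt_of_lt_of_le two_pos h.out)

theorem nontrivial_of_fact (V : Type u) [AddCommGroup V] [Module ℝ V]
    [h : Fact (2 ≤ Module.finrank ℝ V)] : Nontrivial V :=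
  Module.nontrivial_of_finrank_pos (R := ℝ) (lt_of_lt_of_le two_pos h.out)

namespace DualityStructure

variable {V : Type u} [AddCommGroup V] [Module ℝ V] [Fact (2 ≤ Module.finrank ℝ V)]
  (𝔡 : DualityStructure V)

theorem two_le_trace : 2 ≤ 𝔡.trace := by
  rw [trace_eq]
  exact_mod_cast (Fact.out : 2 ≤ Module.finrank ℝ V)

theorem Y_loops {m n : ℕ} (σ : Pairing (Fin m ⊕ Fin n)) (k : ℕ) :
    𝔡.Y ⟨σ, k⟩ = 𝔡.trace ^ k • 𝔡.Y ⟨σ, 0⟩ := by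
  unfold Y
  rw [← map_smul]
  congr 1
  ext J I
  simp [yMat]

/-- The set `H_{m,n} = Y(Hom([m], [n]))`, scaled by the value of the loop. -/
def H (m n : ℕ) : ProfiniteSet ((⨂[ℝ]^m V) →ₗ[ℝ] (⨂[ℝ]^n V)) where
  carrier := Set.range 𝔡.Y
  c := 𝔡.trace
  c_ne_zero := by linarith [𝔡.two_le_trace]
  c_ne_one := by linarith [𝔡.two_le_trace]
  c_ne_neg_one := by linarith [𝔡.two_le_trace]
  zero_notMem := by
    have := nontrivial_of_fact V
    rintro ⟨φ, h⟩
    exact 𝔡.Y_ne_zero φ h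
  smul_mem := by
    rintro _ ⟨⟨σ, k⟩, rfl⟩
    refine ⟨⟨σ, k + 1⟩, ?_⟩
    rw [Y_loops, Y_loops (k := k), smul_smul, pow_succ']
  exists_gen := by
    refine ⟨Set.range fun σ => 𝔡.Y ⟨σ, 0⟩, ?_, Set.finite_range _, ?_⟩
    · rintro _ ⟨σ, rfl⟩
      exact ⟨_, rfl⟩
    · rintro _ ⟨⟨σ, k⟩, rfl⟩
      exact ⟨k, _, ⟨σ, rfl⟩, 𝔡.Y_loops σ k⟩

/-- The composition of elements of `H_{p,n}` and `H_{m,p}`. -/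
def compH {m p n : ℕ} (h : (𝔡.H m p).carrier) (h' : (𝔡.H p n).carrier) : (𝔡.H m n).carrier :=
  ⟨h'.1 ∘ₗ h.1, by
    obtain ⟨φ, hφ⟩ := h.2
    obtain ⟨ψ, hψ⟩ := h'.2
    exact ⟨ψ.comp φ, by rw [Y_comp, hφ, hψ]⟩⟩

/-- The tensor product of elements of `H_{m,n}` and `H_{r,s}`. -/
def tensorH {m n r s : ℕ} (h : (𝔡.H m n).carrier) (h' : (𝔡.H r s).carrier) :
    (𝔡.H (m + r) (n + s)).carrier :=
  ⟨tensorMap h.1 h'.1, by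
    obtain ⟨φ, hφ⟩ := h.2
    obtain ⟨ψ, hψ⟩ := h'.2
    exact ⟨φ.tensor ψ, by rw [Y_tensor, hφ, hψ]⟩⟩

/-- The identity of `V^{⊗m}` as an element of `H_{m,m}`. -/
def idH (m : ℕ) : (𝔡.H m m).carrier := ⟨LinearMap.id, BrHom.id m, 𝔡.Y_id m⟩

/-- The product `Q(H_{m,p}) × Q(H_{p,n}) → Q(H_{m,n})` coming from the composition. -/
def mulComp {m p n : ℕ} (f : (𝔡.H m p).QH) (f' : (𝔡.H p n).QH) : (𝔡.H m n).QH :=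
  ProfiniteSet.bilin 𝔡.compH f f'

/-- The product `Q(H_{m,n}) × Q(H_{r,s}) → Q(H_{m+r,n+s})` coming from the tensor product. -/
def mulTensor {m n r s : ℕ} (f : (𝔡.H m n).QH) (f' : (𝔡.H r s).QH) :
    (𝔡.H (m + r) (n + s)).QH :=
  ProfiniteSet.bilin 𝔡.tensorH f f'

theorem mem_supp_mulComp {m p n : ℕ} (f : (𝔡.H m p).QH) (f' : (𝔡.H p n).QH)
    (x : (𝔡.H m n).carrier) : x ∈ (𝔡.H m n).suppQH (𝔡.mulComp f f') ↔
      ∃ a ∈ (𝔡.H m p).suppQH f, ∃ b ∈ (𝔡.H p n).suppQH f', 𝔡.compH a b = x :=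
  ProfiniteSet.mem_suppQH_bilin
    (fun _ _ => Subtype.ext (LinearMap.comp_smul _ _ _))
    (fun _ _ => Subtype.ext (LinearMap.smul_comp _ _ _)) f f' x

theorem mem_supp_mulTensor {m n r s : ℕ} (f : (𝔡.H m n).QH) (f' : (𝔡.H r s).QH)
    (x : (𝔡.H (m + r) (n + s)).carrier) : x ∈ (𝔡.H (m + r) (n + s)).suppQH (𝔡.mulTensor f f') ↔
      ∃ a ∈ (𝔡.H m n).suppQH f, ∃ b ∈ (𝔡.H r s).suppQH f', 𝔡.tensorH a b = x :=
  ProfiniteSet.mem_suppQH_bilin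
    (fun _ _ => Subtype.ext (tensorMap_smul_left _ _ _))
    (fun _ _ => Subtype.ext (tensorMap_smul_right _ _ _)) f f' x

/-- The profinite idempotent completion `Q = ∏_{m,n} Q(H_{m,n})`. -/
def Q : Type u := ∀ m n : ℕ, (𝔡.H m n).QH

namespace Q

instance : AddCommMonoid 𝔡.Q := inferInstanceAs (AddCommMonoid (∀ m n : ℕ, (𝔡.H m n).QH))

instance : CompleteMonoid 𝔡.Q := inferInstanceAs (CompleteMonoid (∀ m n : ℕ, (𝔡.H m n).QH))

instance : IdemContinuous 𝔡.Q := inferInstanceAs (IdemContinuous (∀ m n : ℕ, (𝔡.H m n).QH))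

end Q

end DualityStructure

namespace DualityStructure

variable {V : Type u} [AddCommGroup V] [Module ℝ V] [Fact (2 ≤ Module.finrank ℝ V)]
  {𝔡 : DualityStructure V}

/-- Transport along equalities of the indices. -/
def castQ {m n m' n' : ℕ} (hm : m = m') (hn : n = n') (f : (𝔡.H m n).QH) : (𝔡.H m' n').QH :=
  match m', n', hm, hn with
  | _, _, rfl, rfl => f

theorem isum_apply {I : Type u} (f : I → 𝔡.Q) (m n : ℕ) :
    (isum f : 𝔡.Q) m n = isum fun i => f i m n := rfl

theorem supp_isum {m n : ℕ} {I : Type u} (f : I → (𝔡.H m n).QH) :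
    (𝔡.H m n).suppQH (isum f) = ⋃ i, (𝔡.H m n).suppQH (f i) :=
  (𝔡.H m n).suppQH_isum f

theorem supp_add {m n : ℕ} (f g : 𝔡.Q) :
    (𝔡.H m n).suppQH ((f + g) m n) = (𝔡.H m n).suppQH (f m n) ∪ (𝔡.H m n).suppQH (g m n) :=
  (𝔡.H m n).suppQH_add _ _

theorem supp_zero {m n : ℕ} : (𝔡.H m n).suppQH ((0 : 𝔡.Q) m n) = ∅ :=
  (𝔡.H m n).suppQH_zero

theorem Q_ext {f g : 𝔡.Q} (h : ∀ m n x, x ∈ (𝔡.H m n).suppQH (f m n) ↔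
    x ∈ (𝔡.H m n).suppQH (g m n)) : f = g :=
  funext fun m => funext fun n => (𝔡.H m n).suppQH_injective (Set.ext (h m n))

/-! #### The composition semiring -/

/-- The product of `Q^c`: `(f · f')_{m,n} = ∑_{p ∈ ℕ} f_{m,p} · f'_{p,n}`. -/
def mulC (f f' : 𝔡.Q) : 𝔡.Q := fun m n =>
  isum fun p : ULift.{u} ℕ => 𝔡.mulComp (f m p.down) (f' p.down n)

/-- The unit of `Q^c`: the identities on the diagonal. -/
def oneC : 𝔡.Q := fun m n =>
  if h : m = n then castQ rfl h (ProfiniteSet.pure (𝔡.idH m) 1) else 0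

theorem mem_mulC (f f' : 𝔡.Q) (m n : ℕ) (x : (𝔡.H m n).carrier) :
    x ∈ (𝔡.H m n).suppQH (mulC f f' m n) ↔ ∃ p, ∃ a ∈ (𝔡.H m p).suppQH (f m p),
      ∃ b ∈ (𝔡.H p n).suppQH (f' p n), 𝔡.compH a b = x := by
  unfold mulC
  rw [supp_isum]
  simp only [Set.mem_iUnion, mem_supp_mulComp, ULift.exists]

theorem mem_oneC_self (m : ℕ) (x : (𝔡.H m m).carrier) :
    x ∈ (𝔡.H m m).suppQH (oneC m m) ↔ x = 𝔡.idH m := by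
  have : (oneC m m : (𝔡.H m m).QH) = ProfiniteSet.pure (𝔡.idH m) 1 := dif_pos rfl
  rw [this, ProfiniteSet.suppQH_pure_one, Set.mem_singleton_iff]

theorem mem_oneC_ne {m n : ℕ} (h : m ≠ n) (x : (𝔡.H m n).carrier) :
    x ∉ (𝔡.H m n).suppQH (oneC m n) := by
  have : (oneC m n : (𝔡.H m n).QH) = 0 := dif_neg h
  rw [this, ProfiniteSet.suppQH_zero]
  exact Set.notMem_empty x

/-- The semiring structure of `Q^c`. -/
@[reducible] def semiringC : Semiring 𝔡.Q where
  toAddCommMonoid := inferInstance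
  mul := mulC
  one := oneC
  mul_assoc f g h := Q_ext fun m n x => by
    change x ∈ (𝔡.H m n).suppQH (mulC (mulC f g) h m n) ↔
      x ∈ (𝔡.H m n).suppQH (mulC f (mulC g h) m n)
    simp only [mem_mulC]
    constructor
    · rintro ⟨p, _, ⟨q, a, ha, b, hb, rfl⟩, c, hc, rfl⟩
      exact ⟨q, a, ha, _, ⟨p, b, hb, c, hc, rfl⟩, Subtype.ext (LinearMap.comp_assoc _ _ _)⟩
    · rintro ⟨q, a, ha, _, ⟨p, b, hb, c, hc, rfl⟩, rfl⟩
      exact ⟨p, _, ⟨q, a, ha, b, hb, rfl⟩, c, hc, Subtype.ext (LinearMap.comp_assoc _ _ _).symm⟩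
  one_mul f := Q_ext fun m n x => by
    change x ∈ (𝔡.H m n).suppQH (mulC oneC f m n) ↔ _
    rw [mem_mulC]
    constructor
    · rintro ⟨p, a, ha, b, hb, rfl⟩
      by_cases h : m = p
      · subst h
        rw [mem_oneC_self] at ha
        subst ha
        exact hb
      · exact absurd ha (mem_oneC_ne h a)
    · intro hx
      exact ⟨m, _, (mem_oneC_self m _).2 rfl, x, hx, rfl⟩
  mul_one f := Q_ext fun m n x => by
    change x ∈ (𝔡.H m n).suppQH (mulC f oneC m n) ↔ _
    rw [mem_mulC]
    constructor
    · rintro ⟨p, a, ha, b, hb, rfl⟩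
      by_cases h : p = n
      · subst h
        rw [mem_oneC_self] at hb
        subst hb
        exact ha
      · exact absurd hb (mem_oneC_ne h b)
    · intro hx
      exact ⟨n, x, hx, _, (mem_oneC_self n _).2 rfl, rfl⟩
  left_distrib f g h := Q_ext fun m n x => by
    change x ∈ (𝔡.H m n).suppQH (mulC f (g + h : 𝔡.Q) m n) ↔
      x ∈ (𝔡.H m n).suppQH ((mulC f g + mulC f h : 𝔡.Q) m n)
    rw [supp_add, Set.mem_union, mem_mulC, mem_mulC, mem_mulC]
    simp only [supp_add, Set.mem_union, or_and_right, exists_or, and_or_left]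
  right_distrib f g h := Q_ext fun m n x => by
    change x ∈ (𝔡.H m n).suppQH (mulC (f + g : 𝔡.Q) h m n) ↔
      x ∈ (𝔡.H m n).suppQH ((mulC f h + mulC g h : 𝔡.Q) m n)
    rw [supp_add, Set.mem_union, mem_mulC, mem_mulC, mem_mulC]
    simp only [supp_add, Set.mem_union, or_and_right, exists_or]
  zero_mul f := Q_ext fun m n x => by
    change x ∈ (𝔡.H m n).suppQH (mulC (0 : 𝔡.Q) f m n) ↔ x ∈ (𝔡.H m n).suppQH ((0 : 𝔡.Q) m n)
    rw [mem_mulC]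
    simp [supp_zero]
  mul_zero f := Q_ext fun m n x => by
    change x ∈ (𝔡.H m n).suppQH (mulC f (0 : 𝔡.Q) m n) ↔ x ∈ (𝔡.H m n).suppQH ((0 : 𝔡.Q) m n)
    rw [mem_mulC]
    simp [supp_zero]

theorem mulC_isum (s : 𝔡.Q) {I : Type u} (f : I → 𝔡.Q) :
    mulC s (isum f) = isum fun i => mulC s (f i) :=
  Q_ext fun m n x => by
    simp only [isum_apply, mem_mulC, supp_isum, Set.mem_iUnion]
    constructor
    · rintro ⟨p, a, ha, b, ⟨i, hb⟩, h⟩; exact ⟨i, p, a, ha, b, hb, h⟩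
    · rintro ⟨i, p, a, ha, b, hb, h⟩; exact ⟨p, a, ha, b, ⟨i, hb⟩, h⟩

theorem isum_mulC (s : 𝔡.Q) {I : Type u} (f : I → 𝔡.Q) :
    mulC (isum f) s = isum fun i => mulC (f i) s :=
  Q_ext fun m n x => by
    simp only [isum_apply, mem_mulC, supp_isum, Set.mem_iUnion]
    constructor
    · rintro ⟨p, a, ⟨i, ha⟩, b, hb, h⟩; exact ⟨i, p, a, ha, b, hb, h⟩
    · rintro ⟨i, p, a, ha, b, hb, h⟩; exact ⟨p, a, ⟨i, ha⟩, b, hb, h⟩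

variable (𝔡) in
/-- The composition semiring `Q^c`. -/
def Qc : Type u := 𝔡.Q

instance : Semiring 𝔡.Qc := semiringC
instance : CompleteMonoid 𝔡.Qc := inferInstanceAs (CompleteMonoid 𝔡.Q)
instance : IdemContinuous 𝔡.Qc := inferInstanceAs (IdemContinuous 𝔡.Q)
instance : CompleteSemiring 𝔡.Qc := ⟨fun s _ f => mulC_isum s f, fun s _ f => isum_mulC s f⟩

/-! #### The monoidal semiring -/

/-- The product of `Q^m`: `(f × f')_{m,n} = ∑_{p + r = m, q + s = n} f_{p,q} × f'_{r,s}`. -/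
def mulM (f f' : 𝔡.Q) : 𝔡.Q := fun m n =>
  ∑ x : Finset.HasAntidiagonal.antidiagonal m, ∑ y : Finset.HasAntidiagonal.antidiagonal n,
    castQ (Finset.HasAntidiagonal.mem_antidiagonal.1 x.2)
      (Finset.HasAntidiagonal.mem_antidiagonal.1 y.2)
      (𝔡.mulTensor (f x.1.1 y.1.1) (f' x.1.2 y.1.2))

/-- The unit of `Q^m`. -/
def oneM : 𝔡.Q := fun m n =>
  if h : 0 = m ∧ 0 = n then castQ h.1 h.2 (ProfiniteSet.pure (𝔡.idH 0) 1) else 0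

variable (𝔡) in
/-- The disjoint union of all `H_{m,n}`. -/
def Mor : Type u := Σ x : ℕ × ℕ, (𝔡.H x.1 x.2).carrier

theorem Mor_ext {m n m' n' : ℕ} {a : (𝔡.H m n).carrier} {b : (𝔡.H m' n').carrier}
    (hm : m = m') (hn : n = n')
    (h : ∀ x, TensorPower.cast ℝ V hn (a.1 x) = b.1 (TensorPower.cast ℝ V hm x)) :
    (⟨(m, n), a⟩ : 𝔡.Mor) = ⟨(m', n'), b⟩ := by
  subst hm hn
  congr 1
  apply Subtype.ext
  refine LinearMap.ext fun x => ?_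
  simpa using h x

instance : Monoid 𝔡.Mor where
  mul a b := ⟨(a.1.1 + b.1.1, a.1.2 + b.1.2), 𝔡.tensorH a.2 b.2⟩
  one := ⟨(0, 0), 𝔡.idH 0⟩
  mul_assoc a b c := Mor_ext (add_assoc _ _ _) (add_assoc _ _ _) (tensorMap_assoc _ _ _)
  one_mul a := Mor_ext (zero_add _) (zero_add _) (tensorMap_id_left _)
  mul_one a := Mor_ext (add_zero _) (add_zero _) (tensorMap_id_right _)

/-- The set of all elements occurring in an element of `Q`. -/
def suppQ (f : 𝔡.Q) : Set 𝔡.Mor := {a | a.2 ∈ (𝔡.H a.1.1 a.1.2).suppQH (f a.1.1 a.1.2)}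

theorem suppQ_injective : Function.Injective (suppQ : 𝔡.Q → Set 𝔡.Mor) := fun _ _ h =>
  Q_ext fun m n x => Set.ext_iff.1 h ⟨(m, n), x⟩

theorem suppQ_add (f g : 𝔡.Q) : suppQ (f + g) = suppQ f ∪ suppQ g := by
  ext a
  simp [suppQ, supp_add]

theorem suppQ_zero : suppQ (0 : 𝔡.Q) = ∅ := by
  ext a
  simp [suppQ, supp_zero]

theorem suppQ_isum {I : Type u} (f : I → 𝔡.Q) : suppQ (isum f) = ⋃ i, suppQ (f i) := by
  ext a
  simp [suppQ, isum_apply, supp_isum]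

theorem mem_castQ {m n m' n' : ℕ} (hm : m = m') (hn : n = n') (f : (𝔡.H m n).QH)
    (x : (𝔡.H m' n').carrier) : x ∈ (𝔡.H m' n').suppQH (castQ hm hn f) ↔
      ∃ a ∈ (𝔡.H m n).suppQH f, (⟨(m, n), a⟩ : 𝔡.Mor) = ⟨(m', n'), x⟩ := by
  subst hm hn
  constructor
  · intro h; exact ⟨x, h, rfl⟩
  · rintro ⟨a, ha, h⟩
    cases h
    exact ha

theorem suppQ_mulM (f f' : 𝔡.Q) : suppQ (mulM f f') = Set.image2 (· * ·) (suppQ f) (suppQ f') := by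
  ext ⟨⟨m, n⟩, x⟩
  change x ∈ (𝔡.H m n).suppQH (mulM f f' m n) ↔ _
  simp only [mulM, ProfiniteSet.suppQH_sum, Finset.mem_univ,
    Set.iUnion_true, Set.mem_iUnion, mem_castQ, mem_supp_mulTensor]
  constructor
  · rintro ⟨⟨⟨p, r⟩, hx⟩, ⟨⟨q, s⟩, hy⟩, _, ⟨a, ha, b, hb, rfl⟩, h⟩
    exact ⟨⟨(p, q), a⟩, ha, ⟨(r, s), b⟩, hb, h⟩
  · rintro ⟨⟨⟨p, q⟩, a⟩, ha, ⟨⟨r, s⟩, b⟩, hb, h⟩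
    have h1 : p + r = m := congrArg (fun z : 𝔡.Mor => z.1.1) h
    have h2 : q + s = n := congrArg (fun z : 𝔡.Mor => z.1.2) h
    exact ⟨⟨(p, r), Finset.HasAntidiagonal.mem_antidiagonal.2 h1⟩,
      ⟨(q, s), Finset.HasAntidiagonal.mem_antidiagonal.2 h2⟩, _, ⟨a, ha, b, hb, rfl⟩, h⟩

theorem suppQ_oneM : suppQ (oneM : 𝔡.Q) = {1} := by
  ext ⟨⟨m, n⟩, x⟩
  change x ∈ (𝔡.H m n).suppQH (oneM m n) ↔ _ = _
  unfold oneM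
  split_ifs with h
  · rw [mem_castQ]
    simp only [ProfiniteSet.suppQH_pure_one, Set.mem_singleton_iff, exists_eq_left]
    exact eq_comm
  · rw [ProfiniteSet.suppQH_zero]
    refine iff_of_false (Set.notMem_empty x) fun h' => h ⟨?_, ?_⟩
    · exact (congrArg (fun z : 𝔡.Mor => z.1.1) h').symm
    · exact (congrArg (fun z : 𝔡.Mor => z.1.2) h').symm

/-- The semiring structure of `Q^m`. -/
@[reducible] def semiringM : Semiring 𝔡.Q where
  toAddCommMonoid := inferInstance
  mul := mulM
  one := oneM
  mul_assoc f g h := suppQ_injective (by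
    change suppQ (mulM (mulM f g) h) = suppQ (mulM f (mulM g h))
    simp only [suppQ_mulM]
    exact Set.image2_assoc mul_assoc)
  one_mul f := suppQ_injective (by
    change suppQ (mulM oneM f) = suppQ (f : 𝔡.Q)
    rw [suppQ_mulM, suppQ_oneM]
    simp)
  mul_one f := suppQ_injective (by
    change suppQ (mulM f oneM) = suppQ (f : 𝔡.Q)
    rw [suppQ_mulM, suppQ_oneM]
    simp)
  left_distrib f g h := suppQ_injective (by
    change suppQ (mulM f (g + h : 𝔡.Q)) = suppQ (mulM f g + mulM f h : 𝔡.Q)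
    simp only [suppQ_mulM, suppQ_add, Set.image2_union_right])
  right_distrib f g h := suppQ_injective (by
    change suppQ (mulM (f + g : 𝔡.Q) h) = suppQ (mulM f h + mulM g h : 𝔡.Q)
    simp only [suppQ_mulM, suppQ_add, Set.image2_union_left])
  zero_mul f := suppQ_injective (by
    change suppQ (mulM (0 : 𝔡.Q) f) = suppQ (0 : 𝔡.Q)
    rw [suppQ_mulM, suppQ_zero, Set.image2_empty_left])
  mul_zero f := suppQ_injective (by
    change suppQ (mulM f (0 : 𝔡.Q)) = suppQ (0 : 𝔡.Q)
    rw [suppQ_mulM, suppQ_zero, Set.image2_empty_right])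

theorem mulM_isum (s : 𝔡.Q) {I : Type u} (f : I → 𝔡.Q) :
    mulM s (isum f) = isum fun i => mulM s (f i) :=
  suppQ_injective (by simp only [suppQ_isum, suppQ_mulM, Set.image2_iUnion_right])

theorem isum_mulM (s : 𝔡.Q) {I : Type u} (f : I → 𝔡.Q) :
    mulM (isum f) s = isum fun i => mulM (f i) s :=
  suppQ_injective (by simp only [suppQ_isum, suppQ_mulM, Set.image2_iUnion_left])

variable (𝔡) in
/-- The monoidal semiring `Q^m`. -/
def Qm : Type u := 𝔡.Q

instance : Semiring 𝔡.Qm := semiringM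
instance : CompleteMonoid 𝔡.Qm := inferInstanceAs (CompleteMonoid 𝔡.Q)
instance : IdemContinuous 𝔡.Qm := inferInstanceAs (IdemContinuous 𝔡.Q)
instance : CompleteSemiring 𝔡.Qm := ⟨fun s _ f => mulM_isum s f, fun s _ f => isum_mulM s f⟩

end DualityStructure

/-! ### Closed manifolds in Euclidean space and fold fields on cylinders -/

section foldFields

open Set unitInterval
open scoped ContDiff

/-- The slice `{k} × ℝ^{D-1}` of `ℝ^D`. -/
def slice {D : ℕ} (k : ℕ) : Set (EuclideanSpace ℝ (Fin D)) :=
  {x | ∀ i : Fin D, (i : ℕ) = 0 → x i = k}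

/-- A smooth local parametrization of a subset `M` of `ℝ^D` by an open subset of `ℝ^d`: an
immersion which is a homeomorphism onto an open subset of `M`. -/
structure LocalParam {D : ℕ} (d : ℕ) (M : Set (EuclideanSpace ℝ (Fin D))) where
  source : Set (EuclideanSpace ℝ (Fin d))
  toFun : EuclideanSpace ℝ (Fin d) → EuclideanSpace ℝ (Fin D)
  isOpen_source : IsOpen source
  contDiffOn : ContDiffOn ℝ ∞ toFun source
  injective_fderiv : ∀ u ∈ source, Function.Injective (fderiv ℝ toFun u)
  mapsTo : MapsTo toFun source M
  isOpenEmbedding : Topology.IsOpenEmbedding (mapsTo.restrict toFun source M)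

/-- A closed `d`-dimensional manifold, smoothly embedded in `ℝ^D` such that every connected
component lies in some slice `{k} × ℝ^{D-1}`, `k ∈ ℕ`. -/
structure IsClosedManifold {D : ℕ} (d : ℕ) (M : Set (EuclideanSpace ℝ (Fin D))) : Prop where
  isCompact : IsCompact M
  exists_param : ∀ x ∈ M, ∃ p : LocalParam d M, x ∈ p.toFun '' p.source
  component_subset_slice : ∀ x ∈ M, ∃ k : ℕ, connectedComponentIn M x ⊆ slice k

/-- The set `s(M)` of all `k` such that `M(k)` is nonempty. -/
def levels {D : ℕ} (M : Set (EuclideanSpace ℝ (Fin D))) : Set ℕ := {k | (M ∩ slice k).Nonempty}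

/-- `M` and `N` are disjoint and no slice meets both of them. -/
structure WellSeparated {D : ℕ} (M N : Set (EuclideanSpace ℝ (Fin D))) : Prop where
  disjoint : Disjoint M N
  levels_disjoint : Disjoint (levels M) (levels N)

/-! #### Maps on the cylinder `[0,1] × M` in local coordinates -/

namespace LocalParam

variable {D d : ℕ} {M : Set (EuclideanSpace ℝ (Fin D))} (p : LocalParam d M)

/-- The domain of the local coordinates of the cylinder. -/
def dom : Set (ℝ × EuclideanSpace ℝ (Fin d)) := Icc 0 1 ×ˢ p.source

open Classical in
/-- A map on the cylinder in local coordinates. -/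
def pullback (F : I × M → ℂ) (x : ℝ × EuclideanSpace ℝ (Fin d)) : ℂ :=
  if h : x ∈ p.dom then F (⟨x.1, h.1⟩, ⟨p.toFun x.2, p.mapsTo h.2⟩) else 0

/-- `x` are the coordinates of the point `z` of the cylinder. -/
def IsCoord (x : ℝ × EuclideanSpace ℝ (Fin d)) (z : I × M) : Prop :=
  x ∈ p.dom ∧ x.1 = z.1 ∧ p.toFun x.2 = z.2

/-- The first derivative in local coordinates (one-sided in time at `t = 0, 1`). -/
def D1 (F : I × M → ℂ) (x : ℝ × EuclideanSpace ℝ (Fin d)) :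
    ℝ × EuclideanSpace ℝ (Fin d) →L[ℝ] ℂ := fderivWithin ℝ (p.pullback F) p.dom x

/-- The second derivative in local coordinates. -/
def D2 (F : I × M → ℂ) (x : ℝ × EuclideanSpace ℝ (Fin d)) :
    ℝ × EuclideanSpace ℝ (Fin d) →L[ℝ] ℝ × EuclideanSpace ℝ (Fin d) →L[ℝ] ℂ :=
  fderivWithin ℝ (p.D1 F) p.dom x

end LocalParam

section jet

variable {T : Type} [NormedAddCommGroup T] [NormedSpace ℝ T]

/-- The kernel of the intrinsic derivative `v ↦ (D²F(v, ·) : ker DF → coker DF)`, where `A = DF`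
and `B = D²F`. At a point where `j¹F` is transverse to `S₁`, this is the tangent space of the
singular set. -/
def singTangent (A : T →L[ℝ] ℂ) (B : T →L[ℝ] T →L[ℝ] ℂ) : Set T :=
  {v | ∀ w, A w = 0 → ∃ w', B v w = A w'}

/-- The conditions on a singular point of a fold map in terms of `A = DF` and `B = D²F`. -/
structure IsFoldJet (A : T →L[ℝ] ℂ) (B : T →L[ℝ] T →L[ℝ] ℂ) : Prop where
  /-- The jet lies in `S₁`. -/
  rank_eq_one : Module.finrank ℝ (LinearMap.range A.toLinearMap) = 1
  /-- `j¹F` is transverse to `S₁`: the intrinsic derivative is onto `Hom(ker DF, coker DF)`. -/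
  transverse : ∀ C : T →L[ℝ] ℂ, ∃ v, ∀ w, A w = 0 → ∃ w', C w - B v w = A w'
  /-- `T S(F) + ker DF = TW`. -/
  tangent_add_ker : ∀ x : T, ∃ v ∈ singTangent A B, ∃ w, A w = 0 ∧ x = v + w

end jet

variable {D : ℕ} (d : ℕ) {M : Set (EuclideanSpace ℝ (Fin D))}

/-- Smooth maps `[0,1] × M → ℂ`. -/
def IsSmoothOnCylinder (F : I × M → ℂ) : Prop :=
  ∀ p : LocalParam d M, ContDiffOn ℝ ∞ (p.pullback F) p.dom

/-- The singular set `S(F)`. -/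
def singSet (F : I × M → ℂ) : Set (I × M) :=
  {z | ∃ (p : LocalParam d M) (x : _), p.IsCoord x z ∧ ¬ Function.Surjective (p.D1 F x)}

/-- Fold maps `[0,1] × M → ℂ`. -/
structure IsFoldMap (F : I × M → ℂ) : Prop where
  smooth : IsSmoothOnCylinder d F
  fold : ∀ z ∈ singSet d F, ∀ (p : LocalParam d M) (x : _), p.IsCoord x z →
    IsFoldJet (p.D1 F x) (p.D2 F x)

/-- The singular set of the restriction `F(k)` of `F` to the part of the cylinder in the
`k`-slice. -/
def singSlice (F : I × M → ℂ) (k : ℕ) : Set (I × M) :=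
  {z | z ∈ singSet d F ∧ (z.2 : EuclideanSpace ℝ (Fin D)) ∈ slice k}

/-- The set of all `t` such that `F(k)` has generic imaginary parts over `t`. -/
def genIm (F : I × M → ℂ) (k : ℕ) : Set I :=
  {t | InjOn (fun z => (F z).im) {z | z ∈ singSlice d F k ∧ z.1 = t}}

/-- The set of all `t` such that `S(F(k))` is transverse to `{t} × M(k)`. (All `t` are regular
values of the time function of a cylinder.) -/
def transverseTimes (F : I × M → ℂ) (k : ℕ) : Set I :=
  {t | ∀ z ∈ singSlice d F k, z.1 = t → ∀ (p : LocalParam d M) (x : _), p.IsCoord x z →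
    ∀ y : ℝ × EuclideanSpace ℝ (Fin d), ∃ v ∈ singTangent (p.D1 F x) (p.D2 F x),
      ∃ w : EuclideanSpace ℝ (Fin d), y = v + (0, w)}

/-- Fold fields on the cylinder `[0,1] × M`. -/
structure IsFoldField (F : I × M → ℂ) : Prop where
  isFoldMap : IsFoldMap d F
  zero_mem : ∀ k ∈ levels M, (0 : I) ∈ transverseTimes d F k ∩ genIm d F k
  one_mem : ∀ k ∈ levels M, (1 : I) ∈ transverseTimes d F k ∩ genIm d F k
  genIm_residual : ∀ k ∈ levels M, genIm d F k ∈ residual I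

/-! #### The action functional and the fields on a closed manifold -/

/-- `𝕊(F(k)) = φ`. Here `P` and `Q` enumerate the points of `S(F(k))` at the times `0` and `1`
in the order of increasing imaginary parts; endpoints are joined by an arc if and only if they are
in the same connected component of `S(F(k))`, and every component without endpoints contributes a
loop. -/
def HasSliceAction (F : I × M → ℂ) (k : ℕ) (φ : BrMor) : Prop :=
  ∃ (P : Fin φ.dom → singSlice d F k) (Q : Fin φ.cod → singSlice d F k),
    (∀ i j, i < j → (F (P i)).im < (F (P j)).im) ∧
    (∀ i j, i < j → (F (Q i)).im < (F (Q j)).im) ∧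
    range P = {z | z.1.1 = 0} ∧ range Q = {z | z.1.1 = 1} ∧
    (∀ a b, a ≠ b → (φ.hom.pairing.arc a = b ↔
      ConnectedComponents.mk (Sum.elim P Q a) = ConnectedComponents.mk (Sum.elim P Q b))) ∧
    (φ.hom.loops : ℕ∞) = ENat.card {c : ConnectedComponents (singSlice d F k) //
      ∀ z, ConnectedComponents.mk z = c → z.1.1 ≠ 0 ∧ z.1.1 ≠ 1}

/-- `𝕊(F) = Φ`, that is, `Φ = ⨂_k 𝕊(F(k))`. -/
def HasAction (F : I × M → ℂ) (Φ : BrMor) : Prop :=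
  ∃ φ : ℕ → BrMor, (∀ k, HasSliceAction d F k (φ k)) ∧
    ∃ K, (∀ k ∈ levels M, k < K) ∧ Φ = BrMor.tensorUpTo φ K

variable (M) in
/-- The fields `𝔉(M)` of a closed `d`-manifold `M`: all fold fields `F` on the cylinder `[0,1] × M`
such that `𝕊(F)` is an identity morphism. -/
def FoldFields : Type :=
  {F : I × M → ℂ // IsFoldField d F ∧ ∃ Φ, HasAction d F Φ ∧ Φ.IsIdentity}

end foldFields

/-- The state module `Z(M)` over `S`, the functions from `𝔉(M)` to `S`, where `S` is one of
the semirings `Q^c`, `Q^m`. -/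
abbrev StateModule (S : Type u) {D : ℕ} (d : ℕ) (M : Set (EuclideanSpace ℝ (Fin D))) : Type u :=
  FoldFields d M → S

/-- `Z(M ⊔ N)` and `Z(M) ⊗̂ Z(N)` are isomorphic as two-sided complete semimodules over `S`, by an
isomorphism sending `z ⊗̂ z'` to the function `f ↦ z(f|_M) z'(f|_N)`. -/
def StateModulesIso (S : Type u) [Semiring S] [CompleteMonoid S] [IdemContinuous S] [CompleteSemiring S]
    {D : ℕ} (d : ℕ) (M N : Set (EuclideanSpace ℝ (Fin D)))
    (ρ : FoldFields d (M ∪ N) → FoldFields d M × FoldFields d N) : Prop :=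
  ∃ e : TensorHat S (StateModule S d M) (StateModule S d N) ≃ₗ[S] StateModule S d (M ∪ N),
    (∀ (s : S) x, e (op s • x) = op s • e x) ∧
    (∀ (J : Type u) (x : J → TensorHat S (StateModule S d M) (StateModule S d N)),
      e (isum x) = isum fun j => e (x j)) ∧
    ∀ z z' f, e (TensorHat.tmul S z z') f = z (ρ f).1 * z' (ρ f).2

end FoldTFT

end

noncomputable section

namespace FoldTFT

set_option linter.unusedSectionVars false

universe u

/-! ### Complete tensor products of function modules -/

section functionModules

open CompleteMonoid MulOpposite

variable {S : Type u} [Semiring S] [CompleteMonoid S] [IdemContinuous S] [CompleteSemiring S]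
  {A B C : Type}

/-! In an idempotent continuous complete monoid every sum is the supremum of its terms in the
natural order. A tensor is therefore a set of pairs that is balanced over `S` and, in each variable,
closed downwards and under suprema. For modules of functions on `A` and on `B`, such a set is
determined by a single function on `A × B`. To a set `X` of pairs attach `extSum X`, the supremum of
the products z(a)w(b) over all (z, w) in `X`; to a function g attach `boundedPairs g`, the pairs
whose products lie below g. The two assignments are adjoint (`extSum_le_iff`).

Each `boundedPairs g` is a tensor, so passing from `X` to the tensor it generates does not change
`extSum` (`extSum_gen`). Sums, both scalar actions and elementary tensors are all defined as tensors
generated by unions, images and singletons, so their compatibility with `extSum` is checked on those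
plain sets. On tensors the two assignments are mutually inverse. Every function is the sum of its
one-point parts, and balance moves the scalar of a one-point function across the tensor sign, so
that membership of (s at a, t at b) depends only on the product st (`IsTensor.single_mem_iff`).
Commutativity of `S` plays no role, and one argument covers both `Q^c` and `Q^m`.

The bijection on fields rests on locality. Inside `M ∪ N` the set `M` is the complement of the
closed set `N`, hence relatively open, and so is `N`. A condition on 2-jets at a point over an open
part can be tested in the charts of that part (`forall_coord_iff`), which settles singular sets and
fold conditions; smoothness is compared through the germs of local representatives. The conditions
on generic imaginary parts, on transversality and on the action refer to one slice at a time. By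
well-separation, a slice that meets `M` meets `M ∪ N` only inside `M`, so the singular sets over
that slice are homeomorphic, compatibly with time and with the values of the map (`singSliceHomeo`).

There remains the requirement that 𝕊(F) be an identity, which concerns all slices together. A tensor
product of Brauer morphisms is an identity exactly when every factor is
(`BrMor.isIdentity_tensor_iff`), so this requirement also splits slice by slice. The inverse of
restriction glues two maps along the partition of `M ∪ N` into `M` and `N`. -/

theorem NatLE.mul_left {a b : S} (h : NatLE a b) (c : S) : NatLE (c * a) (c * b) := by
  unfold NatLE at *; rw [← mul_add, h]

theorem NatLE.mul_right {a b : S} (h : NatLE a b) (c : S) : NatLE (a * c) (b * c) := by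
  unfold NatLE at *; rw [← add_mul, h]

theorem natLE_fun_iff {f g : A → S} : NatLE f g ↔ ∀ a, NatLE (f a) (g a) := funext_iff

theorem isum_fun_apply {I : Type u} (f : I → A → S) (a : A) :
    isum f a = isum fun i => f i a := rfl

/-! ### The adjunction between sets of pairs and functions on `A × B` -/

/-- All pairs of functions whose external product is bounded by `g`. -/
def boundedPairs (g : A → B → S) : Set ((A → S) × (B → S)) :=
  {x | ∀ a b, NatLE (x.1 a * x.2 b) (g a b)}

/-- Balance is the associativity (z(a)s)w(b) = z(a)(sw(b)). Closure in one variable holds because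
multiplication by the fixed value of the other function is monotone and distributes over arbitrary
sums. -/
theorem isTensor_boundedPairs (g : A → B → S) : IsTensor S (boundedPairs g) where
  zero_mem a b := by simpa using natLE_zero _
  smul_mem_iff m s n := by simp [boundedPairs, mul_assoc]
  left_mem m n h a b := by
    refine ((natLE_fun_iff.1 h a).mul_right (n b)).trans ?_
    rw [isum_fun_apply, CompleteSemiring.isum_mul]
    exact isum_le fun i => i.2 a b
  right_mem m n h a b := by
    refine ((natLE_fun_iff.1 h b).mul_left (m a)).trans ?_
    rw [isum_fun_apply, CompleteSemiring.mul_isum]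
    exact isum_le fun i => i.2 a b

/-- The sum of the external products of all pairs in `X`. -/
def extSum (X : Set ((A → S) × (B → S))) (a : A) (b : B) : S :=
  isum fun x : X => x.1.1 a * x.1.2 b

theorem natLE_extSum {X : Set ((A → S) × (B → S))} {x : (A → S) × (B → S)} (hx : x ∈ X)
    (a : A) (b : B) : NatLE (x.1 a * x.2 b) (extSum X a b) :=
  le_isum (fun x : X => x.1.1 a * x.1.2 b) ⟨x, hx⟩

/-- The supremum property of sums, read as an adjunction between `extSum` and `boundedPairs`. -/
theorem extSum_le_iff {X : Set ((A → S) × (B → S))} {g : A → B → S} :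
    (∀ a b, NatLE (extSum X a b) (g a b)) ↔ X ⊆ boundedPairs g :=
  ⟨fun h _ hx a b => (natLE_extSum hx a b).trans (h a b),
    fun h a b => isum_le fun x => h x.2 a b⟩

theorem extSum_mono {X Y : Set ((A → S) × (B → S))} (h : X ⊆ Y) (a : A) (b : B) :
    NatLE (extSum X a b) (extSum Y a b) :=
  isum_le fun x => natLE_extSum (h x.2) a b

/-- `boundedPairs (extSum X)` is a tensor containing `X`, hence contains the tensor generated by
`X`; by adjunction the closure adds nothing to the supremum. This is what lets every operation on
tensors be computed on generating sets. -/
theorem extSum_gen (X : Set ((A → S) × (B → S))) (a : A) (b : B) :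
    extSum (TensorHat.gen S X).1 a b = extSum X a b := by
  refine NatLE.antisymm ?_ (extSum_mono (TensorHat.subset_gen X) a b)
  refine extSum_le_iff.2 ?_ a b
  exact TensorHat.gen_subset (g := ⟨_, isTensor_boundedPairs (extSum X)⟩)
    (extSum_le_iff.1 fun a b => NatLE.refl _)

/-- A supremum of suprema; infinite sums of tensors are generated by unions, so this gives their
preservation. -/
theorem extSum_iUnion {I : Type u} (X : I → Set ((A → S) × (B → S))) (a : A) (b : B) :
    extSum (⋃ i, X i) a b = isum fun i => extSum (X i) a b := by
  refine NatLE.antisymm (isum_le fun x => ?_)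
    (isum_le fun i => extSum_mono (Set.subset_iUnion X i) a b)
  obtain ⟨i, hi⟩ := Set.mem_iUnion.1 x.2
  exact (natLE_extSum hi a b).trans (le_isum (fun i => extSum (X i) a b) i)

theorem extSum_union (X Y : Set ((A → S) × (B → S))) (a : A) (b : B) :
    extSum (X ∪ Y) a b = extSum X a b + extSum Y a b := by
  refine NatLE.antisymm (isum_le ?_) ((extSum_mono Set.subset_union_left a b).add_le
    (extSum_mono Set.subset_union_right a b))
  rintro ⟨x, hx | hx⟩
  · exact (natLE_extSum hx a b).trans (natLE_add_left _ _)
  · exact (natLE_extSum hx a b).trans (natLE_add_right _ _)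

/-- A scalar acting on the first function from the left stands at the far left of every product and
comes out of the sum by infinite distributivity. For the right action on the second function the
picture is mirrored. -/
theorem extSum_left (s : S) (X : Set ((A → S) × (B → S))) (a : A) (b : B) :
    extSum ((fun x : (A → S) × (B → S) => (s • x.1, x.2)) '' X) a b = s * extSum X a b := by
  refine NatLE.antisymm (isum_le ?_) ?_
  · rintro ⟨_, x, hx, rfl⟩
    simpa [mul_assoc] using (natLE_extSum hx a b).mul_left s
  · rw [extSum, CompleteSemiring.mul_isum]
    refine isum_le fun x => ?_
    rw [← mul_assoc]
    exact natLE_extSum (Set.mem_image_of_mem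
      (fun x : (A → S) × (B → S) => (s • x.1, x.2)) x.2) a b

theorem extSum_right (s : S) (X : Set ((A → S) × (B → S))) (a : A) (b : B) :
    extSum ((fun x : (A → S) × (B → S) => (x.1, op s • x.2)) '' X) a b = extSum X a b * s := by
  refine NatLE.antisymm (isum_le ?_) ?_
  · rintro ⟨_, x, hx, rfl⟩
    simpa [mul_assoc] using (natLE_extSum hx a b).mul_right s
  · rw [extSum, CompleteSemiring.isum_mul]
    refine isum_le fun x => ?_
    rw [mul_assoc]
    exact natLE_extSum (Set.mem_image_of_mem
      (fun x : (A → S) × (B → S) => (x.1, op s • x.2)) x.2) a b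

/-! ### Decomposition into one-point functions -/

open Classical in
-- At each point exactly one summand can be nonzero. The index set is lifted because summation is
-- indexed by types in the universe of `S`.
theorem isum_single (z : A → S) :
    isum (fun a : ULift.{u} A => (Pi.single a.down (z a.down) : A → S)) = z := by
  refine NatLE.antisymm (isum_le fun a => ?_) (natLE_fun_iff.2 fun a => ?_)
  · refine natLE_fun_iff.2 fun x => ?_
    by_cases h : x = a.down
    · subst h; simpa using NatLE.refl _
    · simpa [h] using natLE_zero _
  · have := natLE_fun_iff.1
      (le_isum (fun a : ULift.{u} A => (Pi.single a.down (z a.down) : A → S)) ⟨a⟩) a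
    simpa using this

open Classical in
theorem single_le (z : A → S) (a : A) : NatLE (Pi.single a (z a)) z := by
  refine natLE_fun_iff.2 fun x => ?_
  by_cases h : x = a
  · subst h; simpa using NatLE.refl _
  · simpa [h] using natLE_zero _

open Classical in
-- The one-point function with value s is the one with value 1 acted on by s from the right, so
-- balance transfers s to the second factor, where it multiplies t from the left. Membership thus
-- depends only on a, b and st.
theorem IsTensor.single_mem_iff {f : Set ((A → S) × (B → S))} (hf : IsTensor S f) (a : A) (b : B)
    (s t : S) : ((Pi.single a s : A → S), (Pi.single b t : B → S)) ∈ f ↔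
      ((Pi.single a 1 : A → S), (Pi.single b (s * t) : B → S)) ∈ f := by
  have h1 : (Pi.single a s : A → S) = op s • Pi.single a 1 := by
    rw [← Pi.single_smul]; simp
  have h2 : (Pi.single b (s * t) : B → S) = s • Pi.single b t := by
    rw [← Pi.single_smul]; simp
  rw [h1, h2]
  exact hf.smul_mem_iff _ _ _

/-- The heart of the comparison: a tensor contains every pair that its own products allow. Closure
under sums reduces this to one-point functions; there balance gathers the product z(a)w(b) in the
second variable, where the bound by a sum of products from `f` can be used. -/
theorem IsTensor.boundedPairs_extSum {f : Set ((A → S) × (B → S))} (hf : IsTensor S f) :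
    boundedPairs (extSum f) = f := by
  classical
  refine Set.Subset.antisymm ?_ (extSum_le_iff.1 fun _ _ => NatLE.refl _)
  rintro ⟨z, w⟩ h
  rw [← isum_single z, ← isum_single w]
  refine hf.isum_left fun a => hf.isum_right fun b => ?_
  rw [hf.single_mem_iff]
  -- The first function is now 1 at a, and the second carries the whole product at b. The hypothesis
  -- at (a, b) bounds it by a sum with one term for each pair in `f`.
  have h1 : NatLE (Pi.single b.down (z a.down * w b.down) : B → S)
      (isum fun x : f => (Pi.single b.down (x.1.1 a.down * x.1.2 b.down) : B → S)) := by
    refine natLE_fun_iff.2 fun y => ?_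
    rw [isum_fun_apply]
    by_cases hy : y = b.down
    · subst hy
      simpa [extSum] using h a.down b.down
    · simpa [hy] using natLE_zero _
  refine hf.mono_right h1 (hf.isum_right fun x => ?_)
  -- Balance used backwards splits x₁(a)x₂(b) again: the pair consists of the one-point parts of x₁
  -- at a and of x₂ at b, and these lie below a pair of `f` in each variable.
  rw [← hf.single_mem_iff]
  exact hf.mono_left (single_le _ _) (hf.mono_right (single_le _ _) x.2)

theorem extSum_boundedPairs (g : A → B → S) (a : A) (b : B) :
    extSum (boundedPairs g) a b = g a b := by
  classical
  refine NatLE.antisymm (extSum_le_iff.2 subset_rfl a b) ?_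
  -- A pair that attains the bound at (a, b): value 1 at a, value g(a, b) at b, zero elsewhere.
  have h : ((Pi.single a 1 : A → S), (Pi.single b (g a b) : B → S)) ∈ boundedPairs g := by
    intro x y
    by_cases hx : x = a
    · by_cases hy : y = b
      · subst hx hy; simpa using NatLE.refl _
      · simpa [hy] using natLE_zero _
    · simpa [hx] using natLE_zero _
  simpa using natLE_extSum h a b

variable (S) in
/-- The complete tensor product of two function modules is the function module of the product. -/
def tensorHatFunEquiv (ρ : C ≃ A × B) : TensorHat S (A → S) (B → S) ≃ₗ[S] (C → S) where
  toFun f c := extSum f.1 (ρ c).1 (ρ c).2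
  invFun g := ⟨boundedPairs fun a b => g (ρ.symm (a, b)), isTensor_boundedPairs _⟩
  left_inv f := Subtype.ext (by simpa using f.2.boundedPairs_extSum)
  right_inv g := by
    funext c
    simp [extSum_boundedPairs]
  map_add' f g := by
    funext c
    rw [TensorHat.add_def, extSum_gen, extSum_union]
    rfl
  map_smul' s f := by
    funext c
    -- By definition `s • f` is generated by the image of `f` under the action on first components,
    -- so the closure is discarded and only the image matters.
    exact (extSum_gen _ _ _).trans (extSum_left s f.1 _ _)

theorem tensorHatFunEquiv_op_smul (ρ : C ≃ A × B) (s : S) (f : TensorHat S (A → S) (B → S)) :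
    tensorHatFunEquiv S ρ (op s • f) = op s • tensorHatFunEquiv S ρ f := by
  funext c
  exact (extSum_gen _ _ _).trans (extSum_right s f.1 _ _)

theorem tensorHatFunEquiv_isum (ρ : C ≃ A × B) {J : Type u}
    (x : J → TensorHat S (A → S) (B → S)) :
    tensorHatFunEquiv S ρ (isum x) = isum fun j => tensorHatFunEquiv S ρ (x j) := by
  funext c
  exact (extSum_gen _ _ _).trans (extSum_iUnion _ _ _)

theorem tensorHatFunEquiv_tmul (ρ : C ≃ A × B) (z : A → S) (w : B → S) (c : C) :
    tensorHatFunEquiv S ρ (TensorHat.tmul S z w) c = z (ρ c).1 * w (ρ c).2 := by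
  refine (extSum_gen _ _ _).trans ?_
  exact NatLE.antisymm (isum_le fun x => by rw [x.2]; exact NatLE.refl _)
    (natLE_extSum (Set.mem_singleton (z, w)) _ _)

end functionModules

/-- State modules are plain function modules, so all that is needed about fields is a bijection `ρ`.
Keeping `S` arbitrary serves both semiring structures on `Q`. -/
theorem stateModulesIso (S : Type u) [Semiring S] [CompleteMonoid S] [IdemContinuous S]
    [CompleteSemiring S] {D d : ℕ} {M N : Set (EuclideanSpace ℝ (Fin D))}
    (ρ : FoldFields d (M ∪ N) ≃ FoldFields d M × FoldFields d N) :
    StateModulesIso S d M N ρ :=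
  ⟨tensorHatFunEquiv S ρ, tensorHatFunEquiv_op_smul ρ, fun _ => tensorHatFunEquiv_isum ρ,
    tensorHatFunEquiv_tmul ρ⟩

/-! ### Identity morphisms of the Brauer category -/

namespace BrMor

/-- Comparing positions as natural numbers allows the criterion to be stated before source and
target are known to agree, avoiding transport along an equality of objects. -/
theorem isIdentity_iff (φ : BrMor) : φ.IsIdentity ↔ φ.hom.loops = 0 ∧
    (∀ i : Fin φ.dom, ∃ j : Fin φ.cod, φ.hom.pairing.arc (.inl i) = .inr j ∧ (j : ℕ) = i) ∧
    (∀ j : Fin φ.cod, ∃ i : Fin φ.dom, φ.hom.pairing.arc (.inr j) = .inl i ∧ (i : ℕ) = j) := by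
  constructor
  · rintro ⟨m, rfl⟩
    exact ⟨rfl, fun i => ⟨i, rfl, rfl⟩, fun i => ⟨i, rfl, rfl⟩⟩
  · rintro ⟨h0, h1, h2⟩
    have hdc : φ.dom = φ.cod := by
      -- If there were more incoming than outgoing points, the incoming point numbered `φ.cod` would
      -- be joined to an outgoing point with the same number, which does not exist; symmetrically in
      -- the other case.
      refine le_antisymm (not_lt.1 fun h => ?_) (not_lt.1 fun h => ?_)
      · obtain ⟨j, -, hj⟩ := h1 ⟨φ.cod, h⟩
        exact j.2.ne hj
      · obtain ⟨j, -, hj⟩ := h2 ⟨φ.dom, h⟩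
        exact j.2.ne hj
    obtain ⟨a, b, ⟨σ, l⟩⟩ := φ
    obtain rfl : a = b := hdc
    obtain rfl : l = 0 := h0
    refine ⟨a, ?_⟩
    have : σ = (BrHom.id a).pairing := by
      refine Pairing.ext ?_
      rintro (i | j)
      · obtain ⟨j, hj, hij⟩ := h1 i
        exact hj.trans (congrArg Sum.inr (Fin.ext hij))
      · obtain ⟨i, hi, hij⟩ := h2 j
        exact hi.trans (congrArg Sum.inl (Fin.ext hij))
    rw [this]
    rfl

/-- Loop numbers add without cancellation, and arcs of a juxtaposition never join the two blocks.
Hence vertical strands of the product come from vertical strands of the factors. -/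
theorem isIdentity_tensor_iff (φ ψ : BrMor) :
    (φ.tensor ψ).IsIdentity ↔ φ.IsIdentity ∧ ψ.IsIdentity := by
  have hl : ∀ i : Fin φ.dom, (φ.tensor ψ).hom.pairing.arc (.inl (Fin.castAdd ψ.dom i)) =
      Sum.map (Fin.castAdd ψ.dom) (Fin.castAdd ψ.cod) (φ.hom.pairing.arc (.inl i)) := by
    intro i
    cases h : φ.hom.pairing.arc (.inl i) <;>
      simp [tensor, BrHom.tensor, Pairing.map, Pairing.sum, h]
  have hl' : ∀ i : Fin φ.cod, (φ.tensor ψ).hom.pairing.arc (.inr (Fin.castAdd ψ.cod i)) =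
      Sum.map (Fin.castAdd ψ.dom) (Fin.castAdd ψ.cod) (φ.hom.pairing.arc (.inr i)) := by
    intro i
    cases h : φ.hom.pairing.arc (.inr i) <;>
      simp [tensor, BrHom.tensor, Pairing.map, Pairing.sum, h]
  have hr : ∀ i : Fin ψ.dom, (φ.tensor ψ).hom.pairing.arc (.inl (Fin.natAdd φ.dom i)) =
      Sum.map (Fin.natAdd φ.dom) (Fin.natAdd φ.cod) (ψ.hom.pairing.arc (.inl i)) := by
    intro i
    cases h : ψ.hom.pairing.arc (.inl i) <;>
      simp [tensor, BrHom.tensor, Pairing.map, Pairing.sum, h]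
  have hr' : ∀ i : Fin ψ.cod, (φ.tensor ψ).hom.pairing.arc (.inr (Fin.natAdd φ.cod i)) =
      Sum.map (Fin.natAdd φ.dom) (Fin.natAdd φ.cod) (ψ.hom.pairing.arc (.inr i)) := by
    intro i
    cases h : ψ.hom.pairing.arc (.inr i) <;>
      simp [tensor, BrHom.tensor, Pairing.map, Pairing.sum, h]
  constructor
  · intro h
    obtain ⟨h0, h1, h2⟩ := (isIdentity_iff _).1 h
    have h0' : φ.hom.loops + ψ.hom.loops = 0 := h0
    have hφ : φ.IsIdentity := by
      refine (isIdentity_iff _).2 ⟨by omega, fun i => ?_, fun i => ?_⟩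
      · obtain ⟨j, hj, hij⟩ := h1 (Fin.castAdd _ i)
        rw [hl] at hj
        -- An arc returning to the incoming side would still return to it in the product, contrary
        -- to the arc there ending at an outgoing point.
        cases h : φ.hom.pairing.arc (.inl i) with
        | inl y => rw [h] at hj; cases hj
        | inr y => rw [h] at hj; cases hj; exact ⟨y, rfl, hij⟩
      · obtain ⟨j, hj, hij⟩ := h2 (Fin.castAdd _ i)
        rw [hl'] at hj
        cases h : φ.hom.pairing.arc (.inr i) with
        | inl y => rw [h] at hj; cases hj; exact ⟨y, rfl, hij⟩
        | inr y => rw [h] at hj; cases hj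
    -- The second block is shifted by `φ.dom` at the bottom and by `φ.cod` at the top. Positions in
    -- `ψ` can be compared only once these shifts agree, so the first factor has to be treated
    -- first.
    have hdc : φ.dom = φ.cod := by obtain ⟨m, rfl⟩ := hφ; rfl
    refine ⟨hφ, (isIdentity_iff _).2 ⟨by omega, fun i => ?_, fun i => ?_⟩⟩
    · obtain ⟨j, hj, hij⟩ := h1 (Fin.natAdd _ i)
      rw [hr] at hj
      cases h : ψ.hom.pairing.arc (.inl i) with
      | inl y => rw [h] at hj; cases hj
      | inr y =>
        rw [h] at hj; cases hj
        simp only [Fin.val_natAdd] at hij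
        exact ⟨y, rfl, by omega⟩
    · obtain ⟨j, hj, hij⟩ := h2 (Fin.natAdd _ i)
      rw [hr'] at hj
      cases h : ψ.hom.pairing.arc (.inr i) with
      | inl y =>
        rw [h] at hj; cases hj
        simp only [Fin.val_natAdd] at hij
        exact ⟨y, rfl, by omega⟩
      | inr y => rw [h] at hj; cases hj
  · rintro ⟨⟨a, rfl⟩, ⟨b, rfl⟩⟩
    refine (isIdentity_iff _).2 ⟨rfl, fun i => ?_, fun i => ?_⟩
    · induction i using Fin.addCases with
      | left i => exact ⟨Fin.castAdd b i, hl i, rfl⟩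
      | right i => exact ⟨Fin.natAdd a i, hr i, rfl⟩
    · induction i using Fin.addCases with
      | left i => exact ⟨Fin.castAdd b i, hl' i, rfl⟩
      | right i => exact ⟨Fin.natAdd a i, hr' i, rfl⟩

theorem isIdentity_tensorUpTo_iff (φ : ℕ → BrMor) (K : ℕ) :
    (tensorUpTo φ K).IsIdentity ↔ ∀ k < K, (φ k).IsIdentity := by
  induction K with
  | zero => exact iff_of_true ⟨0, rfl⟩ fun k hk => absurd hk k.not_lt_zero
  | succ K ih => rw [tensorUpTo, isIdentity_tensor_iff, ih, Nat.forall_lt_succ_right]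

end BrMor

/-! ### Restriction to relatively open subsets -/

section restriction

open Set unitInterval Topology
open scoped ContDiff Set.Notation

variable {D d : ℕ} {M M' : Set (EuclideanSpace ℝ (Fin D))}

/-- The inclusion of cylinders `[0,1] × M ⊆ [0,1] × M'`. -/
def cylIncl (h : M ⊆ M') (z : I × M) : I × M' := (z.1, Set.inclusion h z.2)

theorem isEmbedding_cylIncl (h : M ⊆ M') : IsEmbedding (cylIncl h) :=
  IsEmbedding.id.prodMap (IsEmbedding.inclusion h)

/-! ### Charts and jets under restriction -/

namespace LocalParam

/-- A local parametrization of a relatively open subset is a local parametrization. -/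
def extend (h : M ⊆ M') (ho : IsOpen (M' ↓∩ M)) (p : LocalParam d M) : LocalParam d M' where
  source := p.source
  toFun := p.toFun
  isOpen_source := p.isOpen_source
  contDiffOn := p.contDiffOn
  injective_fderiv := p.injective_fderiv
  mapsTo := p.mapsTo.mono_right h
  isOpenEmbedding := (IsOpenEmbedding.inclusion h ho).comp p.isOpenEmbedding

/-- The source of the restriction of a local parametrization to a subset. -/
def restrictSource (M : Set (EuclideanSpace ℝ (Fin D))) (p : LocalParam d M') :
    Set (EuclideanSpace ℝ (Fin d)) :=
  p.source ∩ p.toFun ⁻¹' M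

theorem isOpen_restrictSource (ho : IsOpen (M' ↓∩ M)) (p : LocalParam d M') :
    IsOpen (p.restrictSource M) := by
  -- The preimage is open in the subtype `p.source`; since the source is itself open, its image in
  -- the coordinate space is open.
  have := p.isOpen_source.isOpenMap_subtype_val _ (ho.preimage p.isOpenEmbedding.continuous)
  convert this using 1
  ext u
  simp [restrictSource, MapsTo.val_restrict_apply, and_comm]

/-- The restriction of a local parametrization to a relatively open subset. -/
def restrict (h : M ⊆ M') (ho : IsOpen (M' ↓∩ M)) (p : LocalParam d M') : LocalParam d M where
  source := p.restrictSource M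
  toFun := p.toFun
  isOpen_source := p.isOpen_restrictSource ho
  contDiffOn := p.contDiffOn.mono inter_subset_left
  injective_fderiv u hu := p.injective_fderiv u hu.1
  mapsTo _ hu := hu.2
  -- Followed by the open inclusion of `M` into `M'`, the restricted chart is the old chart on an
  -- open part of its source; the inclusion can then be cancelled.
  isOpenEmbedding := IsOpenEmbedding.of_comp _ (IsOpenEmbedding.inclusion h ho)
    (p.isOpenEmbedding.comp (IsOpenEmbedding.inclusion inter_subset_left
      ((p.isOpen_restrictSource ho).preimage continuous_subtype_val)))

variable (h : M ⊆ M') (ho : IsOpen (M' ↓∩ M)) (p : LocalParam d M') (F : I × M' → ℂ)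
  {x : ℝ × EuclideanSpace ℝ (Fin d)}

theorem mem_restrict_dom_iff :
    x ∈ (p.restrict h ho).dom ↔ x ∈ p.dom ∧ p.toFun x.2 ∈ M := by
  simp [dom, restrict, restrictSource, and_assoc]

theorem restrict_isCoord_iff (z : I × M) :
    (p.restrict h ho).IsCoord x z ↔ p.IsCoord x (cylIncl h z) := by
  constructor
  · rintro ⟨h1, h2, h3⟩
    exact ⟨((p.mem_restrict_dom_iff h ho).1 h1).1, h2, h3⟩
  · rintro ⟨h1, h2, h3⟩
    refine ⟨(p.mem_restrict_dom_iff h ho).2 ⟨h1, ?_⟩, h2, h3⟩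
    rw [h3]
    exact z.2.2

/-- Restriction imposes an open condition on the space coordinate only and leaves the time interval
alone. So the domains have the same germ even at times 0 and 1, where they are not neighbourhoods of
the point. -/
theorem restrict_dom_eventuallyEq (hx : x ∈ (p.restrict h ho).dom) :
    (p.restrict h ho).dom =ᶠ[𝓝 x] p.dom := by
  have hV : IsOpen (Prod.snd ⁻¹' p.restrictSource M : Set (ℝ × EuclideanSpace ℝ (Fin d))) :=
    (p.isOpen_restrictSource ho).preimage continuous_snd
  filter_upwards [hV.mem_nhds hx.2] with y hy
  exact propext ((p.mem_restrict_dom_iff h ho).trans (and_iff_left hy.2))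

/-- The two representatives may differ off the smaller domain, where one of them takes its default
value 0. Agreement on that domain suffices, because all derivatives are taken within it. -/
theorem eqOn_restrict_pullback :
    EqOn ((p.restrict h ho).pullback (F ∘ cylIncl h)) (p.pullback F) (p.restrict h ho).dom := by
  intro x hx
  rw [pullback, pullback, dif_pos hx, dif_pos ((p.mem_restrict_dom_iff h ho).1 hx).1]
  rfl

/-- A derivative within a set depends only on the germ of the set and on the function there.
Equality on the whole domain, not just at one point, is what allows differentiating again. -/
theorem eqOn_restrict_D1 :
    EqOn ((p.restrict h ho).D1 (F ∘ cylIncl h)) (p.D1 F) (p.restrict h ho).dom := by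
  intro x hx
  rw [D1, D1, ← fderivWithin_congr_set (p.restrict_dom_eventuallyEq h ho hx)]
  exact fderivWithin_congr (p.eqOn_restrict_pullback h ho F) (p.eqOn_restrict_pullback h ho F hx)

theorem eqOn_restrict_D2 :
    EqOn ((p.restrict h ho).D2 (F ∘ cylIncl h)) (p.D2 F) (p.restrict h ho).dom := by
  intro x hx
  rw [D2, D2, ← fderivWithin_congr_set (p.restrict_dom_eventuallyEq h ho hx)]
  exact fderivWithin_congr (p.eqOn_restrict_D1 h ho F) (p.eqOn_restrict_D1 h ho F hx)

/-- Smoothness involves all orders, so it is not covered by the comparison of 2-jets; it passes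
between charts because function and domain have the same germ. -/
theorem contDiffWithinAt_pullback (hx : x ∈ (p.restrict h ho).dom)
    (hF : ContDiffOn ℝ ∞ ((p.restrict h ho).pullback (F ∘ cylIncl h)) (p.restrict h ho).dom) :
    ContDiffWithinAt ℝ ∞ (p.pullback F) p.dom x := by
  refine ContDiffWithinAt.congr_set ?_ (p.restrict_dom_eventuallyEq h ho hx)
  exact (hF x hx).congr (fun y hy => (p.eqOn_restrict_pullback h ho F hy).symm)
    (p.eqOn_restrict_pullback h ho F hx).symm

end LocalParam

/-! ### Fold conditions under restriction -/

variable (h : M ⊆ M') (ho : IsOpen (M' ↓∩ M)) (F : I × M' → ℂ)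

include ho in
/-- Conditions on the 2-jet at a point may be tested in local coordinates of a relatively open
subset. -/
theorem forall_coord_iff (z : I × M)
    (P : (ℝ × EuclideanSpace ℝ (Fin d) →L[ℝ] ℂ) →
      (ℝ × EuclideanSpace ℝ (Fin d) →L[ℝ] ℝ × EuclideanSpace ℝ (Fin d) →L[ℝ] ℂ) → Prop) :
    (∀ (p : LocalParam d M) (x : _), p.IsCoord x z →
      P (p.D1 (F ∘ cylIncl h) x) (p.D2 (F ∘ cylIncl h) x)) ↔
    ∀ (p : LocalParam d M') (x : _), p.IsCoord x (cylIncl h z) → P (p.D1 F x) (p.D2 F x) := by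
  constructor
  · intro H p x hx
    have hx' := (p.restrict_isCoord_iff h ho z).2 hx
    rw [← p.eqOn_restrict_D1 h ho F hx'.1, ← p.eqOn_restrict_D2 h ho F hx'.1]
    exact H _ x hx'
  · intro H p x hx
    -- Extending a chart changes neither its source nor its map, so coordinates and jets agree
    -- definitionally.
    exact H (p.extend h ho) x hx

include ho in
theorem cylIncl_mem_singSet_iff (z : I × M) :
    cylIncl h z ∈ singSet d F ↔ z ∈ singSet d (F ∘ cylIncl h) := by
  have := forall_coord_iff (d := d) h ho F z fun A _ => Function.Surjective A
  -- Being singular is an existential statement over charts; its negation, surjectivity of the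
  -- derivative in every chart, has the universal form that can be compared.
  rw [← not_iff_not]
  simp only [singSet, mem_ofPred_eq, not_exists, not_and, not_not]
  exact this.symm

include ho in
theorem isSmoothOnCylinder_comp (hF : IsSmoothOnCylinder d F) :
    IsSmoothOnCylinder d (F ∘ cylIncl h) :=
  fun p => hF (p.extend h ho)

include ho in
theorem isFoldMap_comp (hF : IsFoldMap d F) : IsFoldMap d (F ∘ cylIncl h) where
  smooth := isSmoothOnCylinder_comp h ho F hF.smooth
  fold z hz := (forall_coord_iff h ho F z IsFoldJet).2
    (hF.fold _ ((cylIncl_mem_singSet_iff h ho F z).2 hz))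

include ho in
theorem cylIncl_mem_singSlice_iff (k : ℕ) (z : I × M) :
    cylIncl h z ∈ singSlice d F k ↔ z ∈ singSlice d (F ∘ cylIncl h) k :=
  and_congr (cylIncl_mem_singSet_iff h ho F z) Iff.rfl

/-! ### Slices lying inside the open part -/

variable {k : ℕ} (hk : M' ∩ slice k ⊆ M)

include hk in
theorem exists_cylIncl_eq {z : I × M'} (hz : z ∈ singSlice d F k) : ∃ w, cylIncl h w = z :=
  ⟨(z.1, ⟨z.2, hk ⟨z.2.2, hz.2⟩⟩), rfl⟩

include ho hk in
-- Injectivity over a time involves all singular points of the slice at once; none of them is lost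
-- by restricting, since the slice has no points outside `M`.
theorem genIm_comp : genIm d (F ∘ cylIncl h) k = genIm d F k := by
  ext t
  constructor
  · intro H z hz w hw hzw
    obtain ⟨z, rfl⟩ := exists_cylIncl_eq h F hk hz.1
    obtain ⟨w, rfl⟩ := exists_cylIncl_eq h F hk hw.1
    exact congrArg _ (H ⟨(cylIncl_mem_singSlice_iff h ho F k z).1 hz.1, hz.2⟩
      ⟨(cylIncl_mem_singSlice_iff h ho F k w).1 hw.1, hw.2⟩ hzw)
  · intro H z hz w hw hzw
    exact (isEmbedding_cylIncl h).injective
      (H ⟨(cylIncl_mem_singSlice_iff h ho F k z).2 hz.1, hz.2⟩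
      ⟨(cylIncl_mem_singSlice_iff h ho F k w).2 hw.1, hw.2⟩ hzw)

include ho hk in
theorem transverseTimes_comp :
    transverseTimes d (F ∘ cylIncl h) k = transverseTimes d F k := by
  have key := fun z => forall_coord_iff (d := d) h ho F z fun A B => ∀ y, ∃ v ∈ singTangent A B,
    ∃ w : EuclideanSpace ℝ (Fin d), y = v + (0, w)
  ext t
  constructor
  · intro H z hz ht
    obtain ⟨z, rfl⟩ := exists_cylIncl_eq h F hk hz
    exact (key z).1 (H z ((cylIncl_mem_singSlice_iff h ho F k z).1 hz) ht)
  · intro H z hz ht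
    exact (key z).2 (H _ ((cylIncl_mem_singSlice_iff h ho F k z).2 hz) ht)

/-- The singular sets of `F` and of its restriction agree in a slice that meets `M'` only
inside `M`. -/
def singSliceHomeo : singSlice d (F ∘ cylIncl h) k ≃ₜ singSlice d F k :=
  Equiv.toHomeomorphOfIsInducing
    (Equiv.ofBijective
      (fun z => ⟨cylIncl h z, (cylIncl_mem_singSlice_iff h ho F k z).2 z.2⟩)
      ⟨fun _ _ hzw => Subtype.ext ((isEmbedding_cylIncl h).injective (congrArg Subtype.val hzw)),
        fun z => by
          obtain ⟨w, hw⟩ := exists_cylIncl_eq h F hk z.2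
          exact ⟨⟨w, (cylIncl_mem_singSlice_iff h ho F k w).1 (hw ▸ z.2)⟩, Subtype.ext hw⟩⟩)
    -- Composed with the inclusion into `[0,1] × M'`, the bijection is a restriction of the
    -- embedding of cylinders, so it induces the subspace topology.
    (IsInducing.of_comp (Continuous.subtype_mk
        ((isEmbedding_cylIncl h).continuous.comp continuous_subtype_val) _)
      continuous_subtype_val
      ((isEmbedding_cylIncl h).isInducing.comp IsInducing.subtypeVal))

end restriction

/-! ### The action functional -/

section action

open Set unitInterval Topology

/-- A homeomorphism induces a bijection on connected components. -/
def connectedComponentsCongr {X Y : Type*} [TopologicalSpace X] [TopologicalSpace Y]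
    (e : X ≃ₜ Y) : ConnectedComponents X ≃ ConnectedComponents Y where
  toFun := e.continuous.connectedComponentsMap
  invFun := e.symm.continuous.connectedComponentsMap
  left_inv c := by
    obtain ⟨x, rfl⟩ := ConnectedComponents.surjective_coe c
    exact congrArg ConnectedComponents.mk (e.symm_apply_apply x)
  right_inv c := by
    obtain ⟨x, rfl⟩ := ConnectedComponents.surjective_coe c
    exact congrArg ConnectedComponents.mk (e.apply_symm_apply x)

theorem connectedComponentsCongr_mk {X Y : Type*} [TopologicalSpace X] [TopologicalSpace Y]
    (e : X ≃ₜ Y) (x : X) :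
    connectedComponentsCongr e (ConnectedComponents.mk x) = ConnectedComponents.mk (e x) := rfl

variable {D d : ℕ} {M M' : Set (EuclideanSpace ℝ (Fin D))}

/-- The action of a slice depends only on the singular set as a space over the time interval and
on the imaginary parts on it. -/
theorem HasSliceAction.of_homeo {F : I × M → ℂ} {F' : I × M' → ℂ} {k : ℕ} {φ : BrMor}
    (e : singSlice d F k ≃ₜ singSlice d F' k) (ht : ∀ z, (e z).1.1 = z.1.1)
    (hF : ∀ z, F' (e z) = F z) (H : HasSliceAction d F k φ) : HasSliceAction d F' k φ := by
  obtain ⟨P, Q, hP, hQ, hP0, hQ1, harc, hloops⟩ := H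
  -- A homeomorphism over the time interval carries fibre onto fibre; at times 0 and 1 this
  -- transports the sets of endpoints.
  have hr : ∀ (t : I), e '' {z | z.1.1 = t} = {z | z.1.1 = t} := by
    intro t
    refine Subset.antisymm (image_subset_iff.2 fun z hz => (ht z).trans hz) fun z hz => ?_
    exact ⟨e.symm z, (ht _).symm.trans (by rwa [e.apply_symm_apply]), e.apply_symm_apply z⟩
  refine ⟨e ∘ P, e ∘ Q, ?_, ?_, ?_, ?_, ?_, ?_⟩
  · simpa only [Function.comp_apply, hF] using hP
  · simpa only [Function.comp_apply, hF] using hQ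
  · rw [range_comp, hP0, hr]
  · rw [range_comp, hQ1, hr]
  · intro a b hab
    rw [harc a b hab, ← Sum.comp_elim, Function.comp_apply, Function.comp_apply,
      ← connectedComponentsCongr_mk, ← connectedComponentsCongr_mk, EmbeddingLike.apply_eq_iff_eq]
  · rw [hloops]
    refine ENat.card_congr ((connectedComponentsCongr e).subtypeEquiv fun c => ?_)
    -- The condition that a component has no endpoints ranges over points of the target; these are
    -- reindexed by points of the source.
    rw [e.surjective.forall]
    simp only [← connectedComponentsCongr_mk, EmbeddingLike.apply_eq_iff_eq, ht]

open scoped Set.Notation in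
theorem hasSliceAction_comp_iff (h : M ⊆ M') (ho : IsOpen (M' ↓∩ M)) (F : I × M' → ℂ) {k : ℕ}
    (hk : M' ∩ slice k ⊆ M) (φ : BrMor) :
    HasSliceAction d (F ∘ cylIncl h) k φ ↔ HasSliceAction d F k φ :=
  ⟨HasSliceAction.of_homeo (singSliceHomeo h ho F hk) (fun _ => rfl) fun _ => rfl,
    HasSliceAction.of_homeo (singSliceHomeo h ho F hk).symm
      (fun z => congrArg (fun w => w.1.1) ((singSliceHomeo h ho F hk).apply_symm_apply z))
      (fun z => congrArg (fun w : singSlice d F k => F w) ((singSliceHomeo h ho F hk).apply_symm_apply z))⟩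

/-- An empty slice contributes the tensor unit. Such slices have to be filled in because the action
is a product over all indices below a bound, not only over occupied slices. -/
theorem hasSliceAction_of_notMem_levels (F : I × M → ℂ) {k : ℕ} (hk : k ∉ levels M) :
    HasSliceAction d F k (BrMor.one 0) := by
  have : IsEmpty (singSlice d F k) := ⟨fun z => hk ⟨z.1.2, z.1.2.2, z.2.2⟩⟩
  have : IsEmpty (ConnectedComponents (singSlice d F k)) := Quotient.instIsEmpty
  refine ⟨Fin.elim0, Fin.elim0, fun i => i.elim0, fun i => i.elim0, Subsingleton.elim _ _,
    Subsingleton.elim _ _, ?_, ?_⟩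
  · rintro (a | a) <;> exact a.elim0
  · exact (ENat.card_eq_zero_iff_empty _).2 inferInstance |>.symm

/-- The action of a map is an identity if and only if the action of every slice is an identity. -/
theorem exists_hasAction_isIdentity_iff (F : I × M → ℂ) :
    (∃ Φ, HasAction d F Φ ∧ Φ.IsIdentity) ↔
      (∀ k ∈ levels M, ∃ m, HasSliceAction d F k (BrMor.one m)) ∧ BddAbove (levels M) := by
  constructor
  · rintro ⟨_, ⟨φ, hφ, K, hK, rfl⟩, hid⟩
    -- An action is a finite product whose length exceeds every occupied level, so its existence
    -- already bounds the levels.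
    refine ⟨fun k hk => ?_, K, fun k hk => (hK k hk).le⟩
    obtain ⟨m, hm⟩ := (BrMor.isIdentity_tensorUpTo_iff φ K).1 hid k (hK k hk)
    exact ⟨m, hm ▸ hφ k⟩
  · rintro ⟨H, K, hK⟩
    have H' : ∀ k, ∃ m, HasSliceAction d F k (BrMor.one m) := fun k => by
      by_cases hk : k ∈ levels M
      · exact H k hk
      · exact ⟨0, hasSliceAction_of_notMem_levels F hk⟩
    choose m hm using H'
    -- The bound `K` may itself be an occupied level, whereas the product of length L only runs over
    -- indices below L; hence the length `K + 1`.
    exact ⟨_, ⟨fun k => BrMor.one (m k), hm, K + 1, fun k hk => Nat.lt_succ_of_le (hK hk), rfl⟩,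
      (BrMor.isIdentity_tensorUpTo_iff _ _).2 fun k _ => ⟨m k, rfl⟩⟩

end action

/-! ### Fields on a disjoint union -/

section union

open Set unitInterval Topology
open scoped ContDiff Set.Notation

variable {D d : ℕ} {M N M' : Set (EuclideanSpace ℝ (Fin D))}

/-! ### Locality of the field conditions -/

/-- Membership in `𝔉(M)`. -/
def IsField (d : ℕ) (F : I × M → ℂ) : Prop :=
  IsFoldField d F ∧ ∃ Φ, HasAction d F Φ ∧ Φ.IsIdentity

/-- Fold conditions restrict to any open part. The conditions on whole slices restrict because each
slice occupied by `M` is the full slice of `M'`, and the levels of `M` form a subset of a bounded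
set. -/
theorem IsField.comp (h : M ⊆ M') (ho : IsOpen (M' ↓∩ M)) {F : I × M' → ℂ}
    (hk : ∀ k ∈ levels M, M' ∩ slice k ⊆ M) (hF : IsField d F) : IsField d (F ∘ cylIncl h) := by
  have hlev : levels M ⊆ levels M' := fun k hk => hk.mono (inter_subset_inter_left _ h)
  obtain ⟨⟨h1, h2, h3, h4⟩, h5⟩ := hF
  obtain ⟨h5, h6⟩ := (exists_hasAction_isIdentity_iff F).1 h5
  refine ⟨⟨isFoldMap_comp h ho F h1, fun k hkM => ?_, fun k hkM => ?_, fun k hkM => ?_⟩,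
    (exists_hasAction_isIdentity_iff _).2 ⟨fun k hkM => ?_, h6.mono hlev⟩⟩
  · rw [genIm_comp h ho F (hk k hkM), transverseTimes_comp h ho F (hk k hkM)]
    exact h2 k (hlev hkM)
  · rw [genIm_comp h ho F (hk k hkM), transverseTimes_comp h ho F (hk k hkM)]
    exact h3 k (hlev hkM)
  · rw [genIm_comp h ho F (hk k hkM)]
    exact h4 k (hlev hkM)
  · obtain ⟨m, hm⟩ := h5 k (hlev hkM)
    exact ⟨m, (hasSliceAction_comp_iff h ho F (hk k hkM) _).2 hm⟩

theorem levels_union : levels (M ∪ N) = levels M ∪ levels N := by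
  ext k
  simp only [levels, union_inter_distrib_right, union_nonempty, mem_ofPred_eq, mem_union]

/-- Smoothness and the fold condition are tested point by point, and every point of the cylinder
lies over one of two open parts. -/
theorem isFoldMap_of_comp (hM : IsOpen ((M ∪ N) ↓∩ M)) (hN : IsOpen ((M ∪ N) ↓∩ N))
    {F : I × (M ∪ N : Set _) → ℂ} (h1 : IsFoldMap d (F ∘ cylIncl subset_union_left))
    (h2 : IsFoldMap d (F ∘ cylIncl subset_union_right)) : IsFoldMap d F where
  smooth p x hx := by
    rcases p.mapsTo hx.2 with h | h
    · exact p.contDiffWithinAt_pullback subset_union_left hM F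
        ((p.mem_restrict_dom_iff _ hM).2 ⟨hx, h⟩) (h1.smooth _)
    · exact p.contDiffWithinAt_pullback subset_union_right hN F
        ((p.mem_restrict_dom_iff _ hN).2 ⟨hx, h⟩) (h2.smooth _)
  fold := by
    rintro ⟨t, z, hz | hz⟩ hs
    · exact (forall_coord_iff subset_union_left hM F (t, ⟨z, hz⟩) IsFoldJet).1
        (h1.fold _ ((cylIncl_mem_singSet_iff _ hM F (t, ⟨z, hz⟩)).1 hs))
    · exact (forall_coord_iff subset_union_right hN F (t, ⟨z, hz⟩) IsFoldJet).1
        (h2.fold _ ((cylIncl_mem_singSet_iff _ hN F (t, ⟨z, hz⟩)).1 hs))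

theorem WellSeparated.symm (h : WellSeparated M N) : WellSeparated N M :=
  ⟨h.disjoint.symm, h.levels_disjoint.symm⟩

/-- This is where separation of levels enters: disjointness alone would allow one slice to contain
points of both manifolds and mix their singular sets. -/
theorem WellSeparated.inter_slice_left (h : WellSeparated M N) {k : ℕ} (hk : k ∈ levels M) :
    (M ∪ N) ∩ slice k ⊆ M := by
  rintro x ⟨hx | hx, hxk⟩
  · exact hx
  · exact absurd ⟨x, hx, hxk⟩ (disjoint_left.1 h.levels_disjoint hk)

theorem WellSeparated.inter_slice_right (h : WellSeparated M N) {k : ℕ} (hk : k ∈ levels N) :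
    (M ∪ N) ∩ slice k ⊆ N :=
  union_comm N M ▸ h.symm.inter_slice_left hk

/-- By disjointness, `M` is the complement of the closed set `N` within the union. -/
theorem WellSeparated.isOpen_left (h : WellSeparated M N) (hN : IsClosed N) :
    IsOpen ((M ∪ N) ↓∩ M) := by
  convert hN.isOpen_compl.preimage (continuous_subtype_val (p := (· ∈ M ∪ N))) using 1
  ext ⟨x, hx⟩
  exact ⟨fun hM hN => disjoint_left.1 h.disjoint hM hN, hx.resolve_right⟩

theorem WellSeparated.isOpen_right (h : WellSeparated M N) (hM : IsClosed M) :
    IsOpen ((M ∪ N) ↓∩ N) :=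
  union_comm N M ▸ h.symm.isOpen_left hM

/-- Each occupied level belongs to one of the two manifolds, so every slice condition is inherited
from the corresponding restriction; the level sets of both are bounded, hence so is their union. -/
theorem IsField.of_comp (hMN : WellSeparated M N) (hM : IsOpen ((M ∪ N) ↓∩ M))
    (hN : IsOpen ((M ∪ N) ↓∩ N)) {F : I × (M ∪ N : Set _) → ℂ}
    (h1 : IsField d (F ∘ cylIncl subset_union_left))
    (h2 : IsField d (F ∘ cylIncl subset_union_right)) : IsField d F := by
  obtain ⟨⟨a1, a2, a3, a4⟩, a5⟩ := h1
  obtain ⟨⟨b1, b2, b3, b4⟩, b5⟩ := h2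
  obtain ⟨a5, a6⟩ := (exists_hasAction_isIdentity_iff _).1 a5
  obtain ⟨b5, b6⟩ := (exists_hasAction_isIdentity_iff _).1 b5
  refine ⟨⟨isFoldMap_of_comp hM hN a1 b1, ?_, ?_, ?_⟩,
    (exists_hasAction_isIdentity_iff _).2 ⟨?_, levels_union (M := M) ▸ a6.union b6⟩⟩ <;>
    rw [levels_union] <;> rintro k (hk | hk)
  · rw [← genIm_comp _ hM F (hMN.inter_slice_left hk),
      ← transverseTimes_comp _ hM F (hMN.inter_slice_left hk)]
    exact a2 k hk
  · rw [← genIm_comp _ hN F (hMN.inter_slice_right hk),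
      ← transverseTimes_comp _ hN F (hMN.inter_slice_right hk)]
    exact b2 k hk
  · rw [← genIm_comp _ hM F (hMN.inter_slice_left hk),
      ← transverseTimes_comp _ hM F (hMN.inter_slice_left hk)]
    exact a3 k hk
  · rw [← genIm_comp _ hN F (hMN.inter_slice_right hk),
      ← transverseTimes_comp _ hN F (hMN.inter_slice_right hk)]
    exact b3 k hk
  · rw [← genIm_comp _ hM F (hMN.inter_slice_left hk)]
    exact a4 k hk
  · rw [← genIm_comp _ hN F (hMN.inter_slice_right hk)]
    exact b4 k hk
  · obtain ⟨m, hm⟩ := a5 k hk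
    exact ⟨m, (hasSliceAction_comp_iff _ hM F (hMN.inter_slice_left hk) _).1 hm⟩
  · obtain ⟨m, hm⟩ := b5 k hk
    exact ⟨m, (hasSliceAction_comp_iff _ hN F (hMN.inter_slice_right hk) _).1 hm⟩

/-! ### Gluing of fields -/

open Classical in
/-- The map on the cylinder over `M ∪ N` given by `F` over `M` and by `G` over `N`. -/
def glueCyl (F : I × M → ℂ) (G : I × N → ℂ) (z : I × (M ∪ N : Set _)) : ℂ :=
  if h : (z.2 : EuclideanSpace ℝ (Fin D)) ∈ M then F (z.1, ⟨z.2, h⟩)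
  else G (z.1, ⟨z.2, z.2.2.resolve_left h⟩)

theorem glueCyl_comp_left (F : I × M → ℂ) (G : I × N → ℂ) :
    glueCyl F G ∘ cylIncl subset_union_left = F :=
  funext fun z => dif_pos z.2.2

/-- Gluing gives precedence to the map over `M`; disjointness ensures that this never overrides the
map over `N`. -/
theorem glueCyl_comp_right (h : Disjoint M N) (F : I × M → ℂ) (G : I × N → ℂ) :
    glueCyl F G ∘ cylIncl subset_union_right = G :=
  funext fun z => dif_neg fun hz => disjoint_left.1 h hz z.2.2

theorem glueCyl_comp (F : I × (M ∪ N : Set _) → ℂ) :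
    glueCyl (F ∘ cylIncl subset_union_left) (F ∘ cylIncl subset_union_right) = F := by
  funext z
  unfold glueCyl
  split_ifs <;> rfl

/-- Restriction of fields is a bijection `𝔉(M ⊔ N) ≃ 𝔉(M) × 𝔉(N)`. -/
def fieldsUnionEquiv (hMN : WellSeparated M N) (hM : IsClosed M) (hN : IsClosed N) :
    FoldFields d (M ∪ N) ≃ FoldFields d M × FoldFields d N where
  toFun f := (⟨f.1 ∘ cylIncl subset_union_left, IsField.comp _ (hMN.isOpen_left hN)
      (fun _ => hMN.inter_slice_left) f.2⟩,
    ⟨f.1 ∘ cylIncl subset_union_right, IsField.comp _ (hMN.isOpen_right hM)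
      (fun _ => hMN.inter_slice_right) f.2⟩)
  invFun g := ⟨glueCyl g.1.1 g.2.1, IsField.of_comp hMN (hMN.isOpen_left hN) (hMN.isOpen_right hM)
    ((glueCyl_comp_left g.1.1 g.2.1).symm ▸ g.1.2)
    ((glueCyl_comp_right hMN.disjoint g.1.1 g.2.1).symm ▸ g.2.2)⟩
  left_inv f := Subtype.ext (glueCyl_comp f.1)
  right_inv g := Prod.ext (Subtype.ext (glueCyl_comp_left g.1.1 g.2.1))
    (Subtype.ext (glueCyl_comp_right hMN.disjoint g.1.1 g.2.1))

end union

end FoldTFT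

end

/-! ### The proposition -/

theorem mainTheorem11 (n D : ℕ) (hn : 2 ≤ n) (hD : 2 * n + 1 ≤ D)
    {V : Type*} [AddCommGroup V] [Module ℝ V] [Fact (2 ≤ Module.finrank ℝ V)]
    (𝔡 : FoldTFT.DualityStructure V) (hfaithful : 𝔡.FaithfulOnLoops)
    (M N : Set (EuclideanSpace ℝ (Fin D)))
    (hM : FoldTFT.IsClosedManifold (n - 1) M) (hN : FoldTFT.IsClosedManifold (n - 1) N)
    (hMN : FoldTFT.WellSeparated M N) :
    ∃ ρ : FoldTFT.FoldFields (n - 1) (M ∪ N) ≃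
        FoldTFT.FoldFields (n - 1) M × FoldTFT.FoldFields (n - 1) N,
      (∀ f t (x : M), (ρ f).1.1 (t, x) = f.1 (t, ⟨x, Or.inl x.2⟩)) ∧
      (∀ f t (x : N), (ρ f).2.1 (t, x) = f.1 (t, ⟨x, Or.inr x.2⟩)) ∧
      FoldTFT.StateModulesIso 𝔡.Qc (n - 1) M N ρ ∧
      FoldTFT.StateModulesIso 𝔡.Qm (n - 1) M N ρ :=
  -- Compactness is used through closedness in Euclidean space, which makes both parts of the union
  -- relatively open. The restriction formulas hold by the definition of the bijection.
  ⟨FoldTFT.fieldsUnionEquiv hMN hM.isCompact.isClosed hN.isCompact.isClosed,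
    fun _ _ _ => rfl, fun _ _ _ => rfl, FoldTFT.stateModulesIso _ _, FoldTFT.stateModulesIso _ _⟩
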